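/- Let $\alpha\ge 2$, $T\ge 0$ and $b\le N$ be integers with $\alpha<b/5$, and let $q=b/N$ be the sampling ratio. Fix a positive likelihood $p(x\mid\theta)$, a positive prior $p(\theta)$, a proposal density $\kappa(\theta'\mid\theta)$, a distribution on $\mathbb R$ for a correction variable $V_{cor}$, and a distribution for the initial state $\theta_0$, none of which depends on the dataset. Given a dataset $\mathbf x=(x_1,\dots,x_N)$, one iteration of subsampled MCMC in state $\theta$ does the following, with fresh randomness. It draws a proposal $\theta'\sim \kappa(\cdot\mid\theta)$ and a batch $S\subset\{1,\dots,N\}$ uniformly among the subsets of size $b$ (sampling without replacement). With $r_i=\log\frac{p(x_i\mid\theta')}{p(x_i\mid\theta)}$ and $$\Delta^*=\frac Nb\sum_{i\in S}r_i+\log\frac{p(\theta')\,\kappa(\theta\mid\theta')}{p(\theta)\,\kappa(\theta'\mid\theta)},\qquad s^2=\frac{N^2}{b}\Big(\frac1b\sum_{i\in S}r_i^2-\Big(\frac1b\sum_{i\in S}r_i\Big)^2\Big),$$ it draws $y\sim\mathcal N(\Delta^*,\,2-s^2)$ and $V_{cor}$, and moves to $\theta'$ if $y+V_{cor}>0$,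 otherwise stays at $\theta$. (If $\kappa(\theta\mid\theta')=0$, the proposal is rejected and the logarithm of the ratio in $\Delta^*$ is replaced by $0$ in the released $y$.) Assume that for all data points $x$, all $\theta$, and almost all proposals $\theta'\sim \kappa(\cdot\mid\theta)$, $$\big|\log p(x\mid\theta')-\log p(x\mid\theta)\big|\le\frac{\sqrt b}{N}.$$ Call a randomized algorithm $\mathcal M$ on datasets of size $N$ $(\alpha,\epsilon)$-RDP if $D_\alpha(\mathcal M(\mathbf x)\,\|\,\mathcal M(\mathbf x'))\le\epsilon$ for all $\mathbf x,\mathbf x'$ that differ in at most one entry, where $D_\alpha(P\,\|\,Q)=\frac1{\alpha-1}\log\mathbb E_P\big[(dP/dQ)^{\alpha-1}\big]$ is the Rényi divergence, with value $+\infty$ if $P\not\ll Q$. Then releasing the chain $\theta_0,\theta_1,\dots,\theta_T$ of $T$ such iterations is $(\alpha,T\epsilon')$-RDP, and so is releasing its full transcript ($\theta_0$ and, for every iteration, $\theta'$, $y$, $V_{cor}$ and the new state), where $$\epsilon'=\frac1{\alpha-1}\log\Big(1+q^2\binom\alpha2\min\{4(e^{\epsilon(2)}-1),\,2e^{\epsilon(2)}\}+2\sum_{j=3}^{\alpha}q^j\binom\alpha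 j e^{(j-1)\epsilon(j)}\Big)$$ and $$\epsilon(a)=\frac{5}{2b}+\frac{1}{2(a-1)}\ln\frac{2b}{b-5a}+\frac{2a}{b-5a}.$$ -/

import Mathlib

open MeasureTheory ProbabilityTheory
open scoped ENNReal NNReal

noncomputable section

namespace DPMCMC

/-! ### Rényi differential privacy -/

/-- Rényi divergence of order `α > 1`, with values in the extended reals:
`D_α(P ‖ Q) = (α - 1)⁻¹ log E_P[(dP/dQ)^(α-1)]` if `P ≪ Q`, and `⊤` otherwise. -/
def renyiDiv {Ω : Type*} [MeasurableSpace Ω] (α : ℝ) (P Q : Measure Ω) : EReal :=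
  open Classical in
  if P ≪ Q then
    (((α - 1)⁻¹ : ℝ) : EReal) * ENNReal.log (∫⁻ ω, (P.rnDeriv Q ω) ^ (α - 1) ∂P)
  else ⊤

/-- Adjacent datasets: same size, and they differ (at most) in a single element. -/
def Adjacent {X : Type*} {N : ℕ} (x x' : Fin N → X) : Prop :=
  ∃ i, ∀ j, j ≠ i → x j = x' j

/-- `(α, ε)`-Rényi differential privacy of a randomized algorithm, given by its output law
on each dataset of size `N`. -/
def IsRDP {X Ω : Type*} [MeasurableSpace Ω] {N : ℕ} (A : (Fin N → X) → Measure Ω)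
    (α ε : ℝ) : Prop :=
  ∀ x x' : Fin N → X, Adjacent x x' → renyiDiv α (A x) (A x') ≤ (ε : EReal)

/-! ### The subsampled chain with the noisy Barker acceptance test -/

/-- The data-independent ingredients of the algorithm, on a parameter space `Θ`:
positive likelihood `p(x ∣ θ)` and prior `p(θ)` (normalisation plays no role), a proposal
density `q(θ' ∣ θ)` with respect to a base measure, the distribution of the correction
variable `V_cor`, and the law of the initial state. -/
structure Model (X Θ : Type*) [MeasurableSpace Θ] where
  /-- `lik x θ` is `p(x ∣ θ)`. -/
  lik : X → Θ → ℝ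
  lik_pos : ∀ x θ, 0 < lik x θ
  measurable_lik : ∀ x, Measurable (lik x)
  /-- `prior θ` is `p(θ)`. -/
  prior : Θ → ℝ
  prior_pos : ∀ θ, 0 < prior θ
  measurable_prior : Measurable prior
  /-- The reference measure for the proposal densities. -/
  base : Measure Θ
  sigmaFinite_base : SigmaFinite base
  /-- `prop θ θ'` is `q(θ' ∣ θ)`, the density of proposing `θ'` from `θ`. -/
  prop : Θ → Θ → ℝ
  prop_nonneg : ∀ θ θ', 0 ≤ prop θ θ'
  measurable_prop : Measurable (Function.uncurry prop)
  lintegral_prop : ∀ θ, ∫⁻ θ', ENNReal.ofReal (prop θ θ') ∂base = 1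
  /-- The law of the correction variable `V_cor`. -/
  cor : Measure ℝ
  isProbabilityMeasure_cor : IsProbabilityMeasure cor
  /-- The law of the initial state of the chain. -/
  init : Measure Θ
  isProbabilityMeasure_init : IsProbabilityMeasure init

attribute [instance] Model.sigmaFinite_base Model.isProbabilityMeasure_cor
  Model.isProbabilityMeasure_init

/-- What one iteration produces: `(((θ', y), v), θ₊)` with the proposal `θ'`, the noisy
statistic `y` (a sample from the Gaussian of the batch), the correction noise `v`, and the
new state `θ₊`. -/
abbrev Record (Θ : Type*) : Type _ := ((Θ × ℝ) × ℝ) × Θ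

namespace Model

variable {X Θ : Type*} [MeasurableSpace Θ] (M : Model X Θ)

/-- The proposal kernel `q(· ∣ θ)`. -/
def proposal : Kernel Θ Θ :=
  (Kernel.const Θ M.base).withDensity fun θ θ' => ENNReal.ofReal (M.prop θ θ')

/-- The log-likelihood ratio `r(x) = log (p(x ∣ θ') / p(x ∣ θ))`. -/
def llr (x : X) (θ θ' : Θ) : ℝ := Real.log (M.lik x θ' / M.lik x θ)

/-- `Δ*` of the batch of records with index in `S`, for batch size `b` and data size `N`:
`(N/b) ∑_{i ∈ S} r(x_i) + log (p(θ') q(θ ∣ θ') / (p(θ) q(θ' ∣ θ)))`. -/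
def deltaStar {N : ℕ} (b : ℕ) (x : Fin N → X) (S : Finset (Fin N)) (θ θ' : Θ) : ℝ :=
  (N : ℝ) / b * ∑ i ∈ S, M.llr (x i) θ θ' +
    Real.log ((M.prior θ' * M.prop θ' θ) / (M.prior θ * M.prop θ θ'))

/-- The sample variance `Var(r)` of the log-likelihood ratios over the batch:
mean of squares minus square of the mean. -/
def batchVar {N : ℕ} (b : ℕ) (x : Fin N → X) (S : Finset (Fin N)) (θ θ' : Θ) : ℝ :=
  (∑ i ∈ S, M.llr (x i) θ θ' ^ 2) / b - ((∑ i ∈ S, M.llr (x i) θ θ') / b) ^ 2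

/-- The variance `C - s²_{Δ*}` of the added noise, with `C = 2` and
`s²_{Δ*} = (N²/b) Var(r)`. -/
def noiseVar {N : ℕ} (b : ℕ) (x : Fin N → X) (S : Finset (Fin N)) (θ θ' : Θ) : ℝ :=
  2 - (N : ℝ) ^ 2 / b * M.batchVar b x S θ θ'

/-- The Gaussian `𝒩(Δ*, C - s²_{Δ*})` of the batch with index set `S`. -/
def batchGaussian {N : ℕ} (b : ℕ) (x : Fin N → X) (S : Finset (Fin N)) (θ θ' : Θ) :
    Measure ℝ :=
  gaussianReal (M.deltaStar b x S θ θ') (M.noiseVar b x S θ θ').toNNReal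

lemma measurable_llr (x : X) : Measurable fun p : Θ × Θ => M.llr x p.1 p.2 :=
  (((M.measurable_lik x).comp measurable_snd).div
    ((M.measurable_lik x).comp measurable_fst)).log

lemma measurable_deltaStar {N : ℕ} (b : ℕ) (x : Fin N → X) (S : Finset (Fin N)) :
    Measurable fun p : Θ × Θ => M.deltaStar b x S p.1 p.2 := by
  have h1 := M.measurable_prop
  have h2 : Measurable fun p : Θ × Θ => M.prop p.1 p.2 := h1
  have h3 : Measurable fun p : Θ × Θ => M.prop p.2 p.1 := h1.comp measurable_swap
  have h4 := M.measurable_prior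
  have h5 := fun i => M.measurable_llr (x i)
  unfold deltaStar
  exact ((Finset.measurable_sum _ fun i _ => h5 i).const_mul _).add
    (((h4.comp measurable_snd).mul h3).div ((h4.comp measurable_fst).mul h2)).log

lemma measurable_noiseVar {N : ℕ} (b : ℕ) (x : Fin N → X) (S : Finset (Fin N)) :
    Measurable fun p : Θ × Θ => M.noiseVar b x S p.1 p.2 := by
  have h5 := fun i => M.measurable_llr (x i)
  unfold noiseVar batchVar
  exact measurable_const.sub ((((Finset.measurable_sum _ fun i _ => (h5 i).pow_const 2).div_const
    _).sub (((Finset.measurable_sum _ fun i _ => h5 i).div_const _).pow_const 2)).const_mul _)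

lemma measurable_batchGaussian {N : ℕ} (b : ℕ) (x : Fin N → X) (S : Finset (Fin N)) :
    Measurable fun p : Θ × Θ => M.batchGaussian b x S p.1 p.2 :=
  measurable_gaussianReal.comp
    ((M.measurable_deltaStar b x S).prodMk (M.measurable_noiseVar b x S).real_toNNReal)

/-- The kernel `(θ, θ') ↦` law of the noisy statistic, for a batch that is uniformly
distributed over the `b`-element index sets (subsampling without replacement). -/
def noisy {N : ℕ} (b : ℕ) (x : Fin N → X) : Kernel (Θ × Θ) ℝ where
  toFun p := (N.choose b : ℝ≥0∞)⁻¹ •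
    ∑ S ∈ (Finset.univ : Finset (Fin N)).powersetCard b, M.batchGaussian b x S p.1 p.2
  measurable' := by
    refine Measure.measurable_of_measurable_coe _ fun s hs => ?_
    simp only [Measure.smul_apply, Measure.coe_finsetSum, Finset.sum_apply, smul_eq_mul]
    exact (Finset.measurable_sum _ fun S _ =>
      (Measure.measurable_coe hs).comp (M.measurable_batchGaussian b x S)).const_mul _

/-- The state after an iteration: move to the proposal `θ'` iff `y + v > 0`.
If `p(θ') q(θ ∣ θ') = 0`, so that the acceptance log-ratio is `-∞`, the proposal is
rejected. -/
def next (p : Θ × ((Θ × ℝ) × ℝ)) : Θ :=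
  open Classical in
  if 0 < M.prior p.2.1.1 * M.prop p.2.1.1 p.1 ∧ 0 < p.2.1.2 + p.2.2 then p.2.1.1 else p.1

lemma measurable_next : Measurable M.next := by
  classical
  have h1 : Measurable fun p : Θ × ((Θ × ℝ) × ℝ) => M.prop p.2.1.1 p.1 :=
    M.measurable_prop.comp (f := fun p : Θ × ((Θ × ℝ) × ℝ) => (p.2.1.1, p.1)) (by fun_prop)
  have h2 : Measurable fun p : Θ × ((Θ × ℝ) × ℝ) => M.prior p.2.1.1 :=
    M.measurable_prior.comp (by fun_prop)
  have h3 : Measurable fun p : Θ × ((Θ × ℝ) × ℝ) => p.2.1.2 + p.2.2 := by fun_prop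
  have hs : MeasurableSet {p : Θ × ((Θ × ℝ) × ℝ) |
      0 < M.prior p.2.1.1 * M.prop p.2.1.1 p.1 ∧ 0 < p.2.1.2 + p.2.2} :=
    (measurableSet_lt measurable_const (h2.mul h1)).inter (measurableSet_lt measurable_const h3)
  unfold next
  exact Measurable.ite hs (by fun_prop) (by fun_prop)

/-- One iteration from the state `θ`: draw a proposal, draw a fresh batch and the noisy
statistic, draw the correction noise, and accept or reject. -/
def iteration {N : ℕ} (b : ℕ) (x : Fin N → X) : Kernel Θ (Record Θ) :=
  ((M.proposal ⊗ₖ M.noisy b x) ×ₖ Kernel.const Θ M.cor) ⊗ₖ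
    Kernel.deterministic M.next M.measurable_next

/-- The records of `T` successive iterations, started in a given state. -/
def run {N : ℕ} (b : ℕ) (x : Fin N → X) : (T : ℕ) → Kernel Θ (Fin T → Record Θ)
  | 0 => Kernel.const Θ (Measure.dirac Fin.elim0)
  | T + 1 =>
    (M.iteration b x ⊗ₖ
      (run b x T).comap (fun p : Θ × Record Θ => p.2.2)
        (measurable_snd.comp measurable_snd)).map
      fun p : Record Θ × (Fin T → Record Θ) => (Fin.cons p.1 p.2 : Fin (T + 1) → Record Θ)

/-- The law of the full transcript: initial state and the records of all `T` iterations. -/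
def transcript (b T : ℕ) {N : ℕ} (x : Fin N → X) : Measure (Θ × (Fin T → Record Θ)) :=
  M.init ⊗ₘ M.run b x T

/-- The states `θ_0, θ_1, …, θ_T` read off from a transcript. -/
def states {T : ℕ} (ω : Θ × (Fin T → Record Θ)) : Fin (T + 1) → Θ :=
  Fin.cons ω.1 fun t => (ω.2 t).2

/-- The law of the released chain `θ_0, θ_1, …, θ_T`. -/
def chain (b T : ℕ) {N : ℕ} (x : Fin N → X) : Measure (Fin (T + 1) → Θ) :=
  (M.transcript b T x).map states

/-! Well-definedness: all of the above are genuine probability kernels and measures. -/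

lemma measurable_cons {A : Type*} [MeasurableSpace A] (T : ℕ) :
    Measurable fun p : A × (Fin T → A) => (Fin.cons p.1 p.2 : Fin (T + 1) → A) := by
  refine measurable_pi_lambda _ fun i => ?_
  refine Fin.cases ?_ (fun j => ?_) i
  · simpa using measurable_fst
  · simp only [Fin.cons_succ]
    fun_prop

lemma measurable_states {T : ℕ} : Measurable (states : Θ × (Fin T → Record Θ) → _) :=
  (measurable_cons T).comp (f := fun ω : Θ × (Fin T → Record Θ) => (ω.1, fun t => (ω.2 t).2))
    (by fun_prop)

instance isMarkovKernel_proposal : IsMarkovKernel M.proposal := by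
  refine ⟨fun θ => ⟨?_⟩⟩
  rw [proposal, Kernel.withDensity_apply _ (by exact M.measurable_prop.ennreal_ofReal)]
  simpa using M.lintegral_prop θ

lemma isMarkovKernel_noisy {N b : ℕ} (hb : b ≤ N) (x : Fin N → X) :
    IsMarkovKernel (M.noisy b x) := by
  refine ⟨fun p => ⟨?_⟩⟩
  have h : (N.choose b : ℝ≥0∞) ≠ 0 := by exact_mod_cast (Nat.choose_pos hb).ne'
  have h1 : ∀ S, M.batchGaussian b x S p.1 p.2 Set.univ = 1 := fun S => by
    unfold batchGaussian; exact measure_univ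
  change ((N.choose b : ℝ≥0∞)⁻¹ • ∑ S ∈ (Finset.univ : Finset (Fin N)).powersetCard b,
    M.batchGaussian b x S p.1 p.2) Set.univ = 1
  simp only [Measure.smul_apply, Measure.coe_finsetSum, Finset.sum_apply, smul_eq_mul, h1]
  simp [ENNReal.inv_mul_cancel h (ENNReal.natCast_ne_top _)]

lemma isMarkovKernel_iteration {N b : ℕ} (hb : b ≤ N) (x : Fin N → X) :
    IsMarkovKernel (M.iteration b x) := by
  have := M.isMarkovKernel_noisy hb x
  unfold iteration
  infer_instance

lemma isMarkovKernel_run {N b : ℕ} (hb : b ≤ N) (x : Fin N → X) (T : ℕ) :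
    IsMarkovKernel (M.run b x T) := by
  induction T with
  | zero => unfold run; infer_instance
  | succ T ih =>
    have := M.isMarkovKernel_iteration hb x
    unfold run
    exact Kernel.IsMarkovKernel.map _ (measurable_cons T)

lemma isProbabilityMeasure_transcript {N b : ℕ} (hb : b ≤ N) (x : Fin N → X) (T : ℕ) :
    IsProbabilityMeasure (M.transcript b T x) := by
  have := M.isMarkovKernel_run hb x T
  unfold transcript
  infer_instance

lemma isProbabilityMeasure_chain {N b : ℕ} (hb : b ≤ N) (x : Fin N → X) (T : ℕ) :
    IsProbabilityMeasure (M.chain b T x) := by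
  have := M.isProbabilityMeasure_transcript hb x T
  exact Measure.isProbabilityMeasure_map measurable_states.aemeasurable

end Model

/-! ### The privacy bounds -/

/-- The single-iteration bound `ε(a)` with respect to the batch, for batch size `b`:
`5/(2b) + (1/(2(a-1))) log (2b/(b-5a)) + 2a/(b-5a)`. -/
def batchEps (b : ℕ) (a : ℝ) : ℝ :=
  5 / (2 * b) + 1 / (2 * (a - 1)) * Real.log (2 * b / (b - 5 * a)) + 2 * a / (b - 5 * a)

/-- The amplified bound `ε'` for sampling ratio `q`, order `α` and a function `ε`. -/
def amplifiedEps (ε : ℝ → ℝ) (q : ℝ) (α : ℕ) : ℝ :=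
  1 / ((α : ℝ) - 1) * Real.log
    (1 + q ^ 2 * (α.choose 2 : ℝ) * min (4 * (Real.exp (ε 2) - 1)) (2 * Real.exp (ε 2)) +
      2 * ∑ j ∈ Finset.Icc 3 α,
        q ^ j * (α.choose j : ℝ) * Real.exp (((j : ℝ) - 1) * ε j))

end DPMCMC

end

/-! Why the bound holds.

*Batches.* The assumption `|r_i| ≤ √b / N` puts the variance `2 - s²` of the added noise into
`[1, 2]`, and exchanging one record of a batch moves the mean by at most `2 / √b` and the variance
by at most `5 / b` (`Model.gaussianClose`). Completing the square evaluates `∫ φ₁ ^ a / φ₂ ^ (a - 1)`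
for two Gaussian densities in closed form, and under these constraints it is at most
`exp ((a - 1) ε(a))` (`GaussianClose.integral_le`).

*Subsampling.* Let the datasets differ in the record `i`, and let `P`, `Q` be the densities of the
noisy statistic, mixtures over all batches. In the binomial expansion of `P ^ α / Q ^ (α - 1)` around
`Q` the term of order zero integrates to one and that of order one to zero; the others are bounded
by `∫ |P - Q| ^ k / Q ^ (k - 1)`. Only batches `S` that contain `i`, a fraction `q = b / N` of all,
contribute to `P - Q`. Couple such a uniform `S` with a uniform batch `R` that arises from `S` by
exchanging at most the record `i` (`replace`, `sum_sum_replace`). Joint convexity of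
`u ^ k / z ^ (k - 1)` then bounds the integral by `q ^ k` times a mean of
`∫ |p_S - p'_S| ^ k / p'_R ^ (k - 1)`, where `p_S` and `p'_S` are close to `p'_R`
(`lintegral_mixture_pow_div_pow_le`, `integral_ternary_le`). This gives `amplifiedEps`.

*Composition.* An iteration has the density ratio of its noisy statistic, because its other
ingredients do not depend on the data. Moments of density ratios multiply along the chain
(`HasMoment.compProd`), which gives the claim for the transcript. The chain of states is a function
of the transcript, and push-forwards do not increase the moment (`HasMoment.map`). -/

noncomputable section

namespace DPMCMC

/-! ### Densities with a bounded moment -/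

/-- `f` is a density of `μ` with respect to `ν` whose `α`-th moment is at most `C`. The density is
explicit because the parameter space carries an arbitrary `σ`-algebra, so that jointly measurable
versions of `rnDeriv` for kernels are not available. -/
structure HasMoment {Ω : Type*} [MeasurableSpace Ω] (μ ν : Measure Ω) (f : Ω → ℝ≥0∞) (α : ℝ)
    (C : ℝ≥0∞) : Prop where
  eq_withDensity : μ = ν.withDensity f
  lintegral_le : ∫⁻ ω, f ω ^ α ∂ν ≤ C

lemma HasMoment.refl {Ω : Type*} [MeasurableSpace Ω] (μ : Measure Ω) [IsProbabilityMeasure μ]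
    (α : ℝ) : HasMoment μ μ (fun _ => 1) α 1 := by
  refine ⟨?_, by simp⟩
  have h : (fun _ : Ω => (1 : ℝ≥0∞)) = 1 := rfl
  rw [h, withDensity_one]

/-- Moment bounds multiply under composition of kernels. -/
lemma HasMoment.compProd {A B C : Type*} [MeasurableSpace A] [MeasurableSpace B]
    [MeasurableSpace C] {κ₁ η₁ : Kernel A B} {κ₂ η₂ : Kernel (A × B) C} [IsSFiniteKernel κ₁]
    [IsSFiniteKernel η₁] [IsSFiniteKernel κ₂] [IsSFiniteKernel η₂]
    {f₁ : A × B → ℝ≥0∞} {f₂ : (A × B) × C → ℝ≥0∞} (hf₁ : Measurable f₁) (hf₂ : Measurable f₂)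
    {α : ℝ} (hα : 0 ≤ α) {c₁ c₂ : ℝ≥0∞} {a : A}
    (h₁ : HasMoment (κ₁ a) (η₁ a) (fun b => f₁ (a, b)) α c₁)
    (h₂ : ∀ᵐ b ∂η₁ a, HasMoment (κ₂ (a, b)) (η₂ (a, b)) (fun c => f₂ ((a, b), c)) α c₂) :
    HasMoment ((κ₁ ⊗ₖ κ₂) a) ((η₁ ⊗ₖ η₂) a) (fun p => f₁ (a, p.1) * f₂ ((a, p.1), p.2)) α
      (c₁ * c₂) := by
  have hm₁ : Measurable fun b => f₁ (a, b) := hf₁.comp (by fun_prop)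
  have hm₂ : Measurable fun p : B × C => f₂ ((a, p.1), p.2) := hf₂.comp (by fun_prop)
  have hm₂' : ∀ b, Measurable fun c => f₂ ((a, b), c) := fun b => hf₂.comp (by fun_prop)
  have hm : Measurable fun p : B × C => f₁ (a, p.1) * f₂ ((a, p.1), p.2) :=
    (hm₁.comp measurable_fst).mul hm₂
  have slice : ∀ {F : B × C → ℝ≥0∞}, Measurable F → ∀ (κ : Kernel (A × B) C) [IsSFiniteKernel κ],
      Measurable fun b => ∫⁻ c, F (b, c) ∂κ (a, b) := fun {F} hF κ _ => by
    have := Measurable.lintegral_kernel_prod_right' (κ := κ)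
      (f := fun p : (A × B) × C => F (p.1.2, p.2)) (hF.comp (by fun_prop))
    exact this.comp (measurable_prodMk_left (x := a))
  constructor
  · refine Measure.ext_of_lintegral _ fun g hg => ?_
    rw [lintegral_withDensity_eq_lintegral_mul _ hm hg,
      Kernel.lintegral_compProd _ _ _ hg, Kernel.lintegral_compProd _ _ _ (hm.mul hg),
      h₁.eq_withDensity, lintegral_withDensity_eq_lintegral_mul _ hm₁ (slice hg κ₂)]
    refine lintegral_congr_ae ?_
    filter_upwards [h₂] with b hb
    have hgb : Measurable fun c => g (b, c) := hg.comp measurable_prodMk_left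
    simp only [Pi.mul_apply]
    rw [hb.eq_withDensity, lintegral_withDensity_eq_lintegral_mul _ (hm₂' b) hgb,
      ← lintegral_const_mul _ ((hm₂' b).mul hgb)]
    simp [mul_assoc]
  · rw [Kernel.lintegral_compProd _ _ _ (hm.pow_const α)]
    calc ∫⁻ b, ∫⁻ c, (f₁ (a, b) * f₂ ((a, b), c)) ^ α ∂η₂ (a, b) ∂η₁ a
        = ∫⁻ b, f₁ (a, b) ^ α * ∫⁻ c, f₂ ((a, b), c) ^ α ∂η₂ (a, b) ∂η₁ a := by
          refine lintegral_congr fun b => ?_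
          rw [← lintegral_const_mul _ ((hm₂' b).pow_const α)]
          simp_rw [ENNReal.mul_rpow_of_nonneg _ _ hα]
      _ ≤ ∫⁻ b, f₁ (a, b) ^ α * c₂ ∂η₁ a := by
          refine lintegral_mono_ae ?_
          filter_upwards [h₂] with b hb
          exact mul_le_mul_right hb.lintegral_le _
      _ ≤ c₁ * c₂ := by
          rw [lintegral_mul_const _ (hm₁.pow_const α)]
          exact mul_le_mul_left h₁.lintegral_le _

/-- A moment bound survives a push-forward that loses no information. -/
lemma HasMoment.map_of_leftInverse {A B : Type*} [MeasurableSpace A] [MeasurableSpace B]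
    {μ ν : Measure A} {f : A → ℝ≥0∞} {α : ℝ} {C : ℝ≥0∞} (h : HasMoment μ ν f α C)
    (hf : Measurable f) {m : A → B} {g : B → A} (hm : Measurable m) (hg : Measurable g)
    (hgm : Function.LeftInverse g m) :
    HasMoment (μ.map m) (ν.map m) (fun b => f (g b)) α C := by
  have hfg : Measurable fun b => f (g b) := hf.comp hg
  constructor
  · refine Measure.ext_of_lintegral _ fun u hu => ?_
    have hum : Measurable fun a => u (m a) := hu.comp hm
    rw [lintegral_withDensity_eq_lintegral_mul _ hfg hu, lintegral_map hu hm,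
      lintegral_map (hfg.mul hu) hm, h.eq_withDensity,
      lintegral_withDensity_eq_lintegral_mul _ hf hum]
    simp [hgm _]
  · rw [lintegral_map (hfg.pow_const α) hm]
    simpa [hgm _] using h.lintegral_le

/-- Data processing: a push-forward does not increase the moment. By Young's inequality, the moment
`I` of the new density satisfies `I ≤ C / α + I / β` with `1 / α + 1 / β = 1`; truncation of the
density makes `I` finite, so that it can be absorbed. -/
lemma HasMoment.map {A B : Type*} [MeasurableSpace A] [MeasurableSpace B]
    {μ ν : Measure A} [IsFiniteMeasure μ] [IsFiniteMeasure ν] {f : A → ℝ≥0∞} {α : ℝ} {C : ℝ≥0∞}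
    (h : HasMoment μ ν f α C) (hf : Measurable f) (hα : 1 < α) {g : A → B} (hg : Measurable g) :
    HasMoment (μ.map g) (ν.map g) ((μ.map g).rnDeriv (ν.map g)) α C := by
  have hac : μ ≪ ν := h.eq_withDensity ▸ withDensity_absolutelyContinuous _ _
  set u := (μ.map g).rnDeriv (ν.map g) with hu_def
  have hu : Measurable u := Measure.measurable_rnDeriv _ _
  have hμ : μ.map g = (ν.map g).withDensity u :=
    (Measure.withDensity_rnDeriv_eq _ _ (hac.map hg)).symm
  refine ⟨hμ, ?_⟩
  have hα0 : 0 < α := by linarith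
  have hα1 : 0 < α - 1 := by linarith
  set t : ℕ → B → ℝ≥0∞ := fun n b => min (u b) n with ht_def
  have ht : ∀ n, Measurable (t n) := fun n => hu.min measurable_const
  have htu : ∀ n b, t n b ≤ u b := fun n b => min_le_left _ _
  have key : ∀ n, ∫⁻ b, t n b ^ α ∂(ν.map g) ≤ C := by
    intro n
    have htg : ∀ r : ℝ, Measurable fun a => t n (g a) ^ r := fun r =>
      ((ht n).comp hg).pow_const r
    set I := ∫⁻ b, t n b ^ α ∂(ν.map g) with hI
    have hIfin : I ≠ ∞ := by
      refine ne_top_of_le_ne_top ?_ (lintegral_mono (g := fun _ => (n : ℝ≥0∞) ^ α)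
        fun b => ENNReal.rpow_le_rpow (min_le_right _ _) hα0.le)
      rw [lintegral_const]
      exact ENNReal.mul_ne_top (ENNReal.rpow_ne_top_of_nonneg hα0.le (ENNReal.natCast_ne_top n))
        (measure_ne_top _ _)
    have hconj : α.HolderConjugate α.conjExponent := Real.HolderConjugate.conjExponent hα
    set β := α.conjExponent with hβ
    have hsum : (ENNReal.ofReal α)⁻¹ + (ENNReal.ofReal β)⁻¹ = 1 := by
      rw [← ENNReal.ofReal_inv_of_pos hconj.pos, ← ENNReal.ofReal_inv_of_pos hconj.symm.pos,
        ← ENNReal.ofReal_add (by have := hconj.pos; positivity)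
          (by have := hconj.symm.pos; positivity), hconj.inv_add_inv_eq_one, ENNReal.ofReal_one]
    have h1 : I ≤ C / ENNReal.ofReal α + I / ENNReal.ofReal β := by
      calc I ≤ ∫⁻ b, u b * t n b ^ (α - 1) ∂(ν.map g) := by
            refine lintegral_mono fun b => ?_
            have hsplit : t n b ^ α = t n b ^ (1 : ℝ) * t n b ^ (α - 1) := by
              rw [← ENNReal.rpow_add_of_nonneg _ _ zero_le_one hα1.le]; ring_nf
            rw [hsplit, ENNReal.rpow_one]
            exact mul_le_mul_left (htu n b) _
        _ = ∫⁻ b, t n b ^ (α - 1) ∂(μ.map g) := by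
            rw [hμ, lintegral_withDensity_eq_lintegral_mul _ hu ((ht n).pow_const _)]; rfl
        _ = ∫⁻ a, f a * t n (g a) ^ (α - 1) ∂ν := by
            rw [lintegral_map ((ht n).pow_const _) hg, h.eq_withDensity,
              lintegral_withDensity_eq_lintegral_mul _ hf (htg _)]
            rfl
        _ ≤ ∫⁻ a, f a ^ α / ENNReal.ofReal α + t n (g a) ^ α / ENNReal.ofReal β ∂ν := by
            refine lintegral_mono fun a => ?_
            refine (ENNReal.young_inequality _ _ hconj).trans_eq ?_
            rw [← ENNReal.rpow_mul, hconj.sub_one_mul_conj]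
        _ = (∫⁻ a, f a ^ α ∂ν) / ENNReal.ofReal α + I / ENNReal.ofReal β := by
            simp only [div_eq_mul_inv]
            rw [lintegral_add_left ((hf.pow_const _).mul_const _),
              lintegral_mul_const _ (hf.pow_const _), lintegral_mul_const _
              (htg _), hI, lintegral_map ((ht n).pow_const _) hg]
        _ ≤ C / ENNReal.ofReal α + I / ENNReal.ofReal β := by
            gcongr
            exact h.lintegral_le
    have h2 : I = I / ENNReal.ofReal α + I / ENNReal.ofReal β := by
      rw [div_eq_mul_inv, div_eq_mul_inv, ← mul_add, hsum, mul_one]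
    have h3 : I / ENNReal.ofReal β ≠ ∞ :=
      ENNReal.div_ne_top hIfin (by simpa using hconj.symm.pos)
    have h4 : I / ENNReal.ofReal α ≤ C / ENNReal.ofReal α :=
      (ENNReal.add_le_add_iff_right h3).1 (h2 ▸ h1)
    have h5 : ENNReal.ofReal α ≠ 0 := by simpa using hα0
    simpa [ENNReal.mul_div_cancel h5 ENNReal.ofReal_ne_top] using
      mul_le_mul_right h4 (ENNReal.ofReal α)
  have hsup : ∀ b, u b ^ α = ⨆ n, t n b ^ α := by
    intro b
    have hlim : Filter.Tendsto (fun n => t n b ^ α) Filter.atTop (nhds (u b ^ α)) := by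
      have h1 : Filter.Tendsto (fun n : ℕ => min (u b) n) Filter.atTop (nhds (min (u b) ∞)) :=
        tendsto_const_nhds.min ENNReal.tendsto_nat_nhds_top
      rw [min_top_right] at h1
      exact (ENNReal.continuous_rpow_const.tendsto _).comp h1
    refine tendsto_nhds_unique hlim (tendsto_atTop_iSup fun m n hmn => ?_)
    exact ENNReal.rpow_le_rpow (min_le_min_left _ (by exact_mod_cast hmn)) hα0.le
  simp_rw [hsup]
  rw [lintegral_iSup (fun n => (ht n).pow_const _)]
  · exact iSup_le key
  · intro m n hmn b
    exact ENNReal.rpow_le_rpow (min_le_min_left _ (by exact_mod_cast hmn)) hα0.le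

/-- A moment bound on the density is a bound on the Rényi divergence. -/
lemma HasMoment.renyiDiv_le {Ω : Type*} [MeasurableSpace Ω] {μ ν : Measure Ω}
    [SigmaFinite ν] {f : Ω → ℝ≥0∞} {α ε : ℝ} (hf : Measurable f) (hα : 1 < α)
    (h : HasMoment μ ν f α (ENNReal.ofReal (Real.exp ((α - 1) * ε)))) :
    renyiDiv α μ ν ≤ (ε : EReal) := by
  have hα1 : 0 < α - 1 := by linarith
  have hac : μ ≪ ν := h.eq_withDensity ▸ withDensity_absolutelyContinuous _ _
  have hint : ∫⁻ ω, (μ.rnDeriv ν ω) ^ (α - 1) ∂μ = ∫⁻ ω, f ω ^ α ∂ν := by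
    have hrn : μ.rnDeriv ν =ᵐ[ν] f := by
      rw [h.eq_withDensity]; exact Measure.rnDeriv_withDensity ν hf
    have hrn' : (fun ω => (μ.rnDeriv ν ω) ^ (α - 1)) =ᵐ[μ] fun ω => f ω ^ (α - 1) := by
      filter_upwards [hac.ae_le hrn] with ω hω
      rw [hω]
    rw [lintegral_congr_ae hrn', h.eq_withDensity, lintegral_withDensity_eq_lintegral_mul _ hf (hf.pow_const _)]
    refine lintegral_congr fun ω => ?_
    rw [Pi.mul_apply]
    nth_rewrite 1 [← ENNReal.rpow_one (f ω)]
    rw [← ENNReal.rpow_add_of_nonneg _ _ zero_le_one hα1.le]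
    ring_nf
  rw [renyiDiv, if_pos hac, hint]
  have hlog : ENNReal.log (∫⁻ ω, f ω ^ α ∂ν) ≤ (((α - 1) * ε : ℝ) : EReal) := by
    refine (ENNReal.log_le_log h.lintegral_le).trans_eq ?_
    rw [ENNReal.log_ofReal, if_neg (not_le.2 (Real.exp_pos _)), Real.log_exp]
  refine (mul_le_mul_of_nonneg_left hlog (by exact_mod_cast (inv_pos.2 hα1).le)).trans_eq ?_
  rw [← EReal.coe_mul, inv_mul_cancel_left₀ hα1.ne']

/-! ### Moments of Gaussian density ratios -/

/-- Completing the square: `φ₁ ^ (n + 1) / φ₂ ^ n` is a multiple of a Gaussian density, provided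
that `w = (n + 1) v₂ - n v₁` is positive. -/
lemma gaussianPDFReal_pow_div_pow (μ₁ μ₂ : ℝ) {v₁ v₂ w : ℝ≥0} (hv₁ : 0 < v₁) (hv₂ : 0 < v₂)
    (hw : 0 < w) (n : ℕ) (hwv : (w : ℝ) = (n + 1) * v₂ - n * v₁) (y : ℝ) :
    gaussianPDFReal μ₁ v₁ y ^ (n + 1) / gaussianPDFReal μ₂ v₂ y ^ n =
      √(v₂ / v₁) ^ n * √(v₂ / w) * Real.exp (n * (n + 1) * (μ₁ - μ₂) ^ 2 / (2 * w)) *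
        gaussianPDFReal (((n + 1) * μ₁ * v₂ - n * μ₂ * v₁) / w) (v₁ * v₂ / w) y := by
  have h1 : (0 : ℝ) < v₁ := hv₁
  have h2 : (0 : ℝ) < v₂ := hv₂
  have h3 : (0 : ℝ) < w := hw
  simp only [gaussianPDFReal]
  have s1 : 0 < √(v₁ : ℝ) := Real.sqrt_pos.2 h1
  have s2 : 0 < √(v₂ : ℝ) := Real.sqrt_pos.2 h2
  have s3 : 0 < √(w : ℝ) := Real.sqrt_pos.2 h3
  have sp : 0 < √(2 * Real.pi) := Real.sqrt_pos.2 (by positivity)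
  have e1 : ∀ v : ℝ, √(2 * Real.pi * v) = √(2 * Real.pi) * √v := fun v =>
    Real.sqrt_mul (by positivity) v
  have e2 : √((v₁ * v₂ / w : ℝ≥0) : ℝ) = √(v₁ : ℝ) * √(v₂ : ℝ) / √(w : ℝ) := by
    push_cast
    rw [Real.sqrt_div (by positivity), Real.sqrt_mul h1.le]
  rw [e1, e1, e1, e2, Real.sqrt_div h2.le, Real.sqrt_div h2.le]
  have hexp : Real.exp (-(y - μ₁) ^ 2 / (2 * v₁)) ^ (n + 1) /
      Real.exp (-(y - μ₂) ^ 2 / (2 * v₂)) ^ n =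
      Real.exp (n * (n + 1) * (μ₁ - μ₂) ^ 2 / (2 * w)) *
      Real.exp (-(y - ((n + 1) * μ₁ * v₂ - n * μ₂ * v₁) / w) ^ 2 /
        (2 * ((v₁ * v₂ / w : ℝ≥0) : ℝ))) := by
    rw [← Real.exp_nat_mul, ← Real.exp_nat_mul, ← Real.exp_sub, ← Real.exp_add]
    congr 1
    push_cast
    have h4 : ((n : ℝ) + 1) * v₂ - n * v₁ ≠ 0 := hwv ▸ h3.ne'
    rw [hwv]
    field_simp
    ring
  rw [mul_pow, mul_pow, mul_div_mul_comm, hexp]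
  rw [show ∀ a b c d e : ℝ, a * b * c * (d * e) = (a * b * d) * (c * e) by intros; ring]
  congr 1
  simp only [div_pow, inv_pow, mul_pow, pow_succ]
  field_simp

lemma integrable_gaussianPDFReal_pow_div_pow (μ₁ μ₂ : ℝ) {v₁ v₂ : ℝ≥0} (hv₁ : 0 < v₁)
    (hv₂ : 0 < v₂) (n : ℕ) (hw : 0 < ((n : ℝ) + 1) * v₂ - n * v₁) :
    Integrable fun y => gaussianPDFReal μ₁ v₁ y ^ (n + 1) / gaussianPDFReal μ₂ v₂ y ^ n := by
  simp_rw [gaussianPDFReal_pow_div_pow μ₁ μ₂ (w := ⟨_, hw.le⟩) hv₁ hv₂ hw n rfl]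
  exact (integrable_gaussianPDFReal _ _).const_mul _

lemma integral_gaussianPDFReal_pow_div_pow (μ₁ μ₂ : ℝ) {v₁ v₂ : ℝ≥0} (hv₁ : 0 < v₁)
    (hv₂ : 0 < v₂) (n : ℕ) {w : ℝ} (hw : 0 < w) (hwv : w = ((n : ℝ) + 1) * v₂ - n * v₁) :
    ∫ y, gaussianPDFReal μ₁ v₁ y ^ (n + 1) / gaussianPDFReal μ₂ v₂ y ^ n =
      √(v₂ / v₁) ^ n * √(v₂ / w) * Real.exp (n * (n + 1) * (μ₁ - μ₂) ^ 2 / (2 * w)) := by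
  simp_rw [gaussianPDFReal_pow_div_pow μ₁ μ₂ (w := ⟨w, hw.le⟩) hv₁ hv₂ hw n hwv]
  rw [integral_const_mul, integral_gaussianPDFReal_eq_one, mul_one]
  · rfl
  · exact (div_pos (mul_pos hv₁ hv₂) hw).ne'

/-- The parameters of the acceptance-test Gaussians of two batches that differ in one record:
variances in `[1, 2]` at distance at most `5 / b`, means at distance at most `2 / √b`. -/
structure GaussianClose (b : ℕ) (μ₁ μ₂ : ℝ) (v₁ v₂ : ℝ≥0) : Prop where
  one_le_left : 1 ≤ v₁
  one_le_right : 1 ≤ v₂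
  right_le_two : v₂ ≤ 2
  abs_var_sub_le : |(v₁ : ℝ) - v₂| ≤ 5 / b
  sq_mean_sub_le : (μ₁ - μ₂) ^ 2 ≤ 4 / b

namespace GaussianClose

variable {b n : ℕ} {μ₁ μ₂ : ℝ} {v₁ v₂ : ℝ≥0}

lemma le_weighted_var (h : GaussianClose b μ₁ μ₂ v₁ v₂) :
    1 - 5 * ((n : ℝ) + 1) / b ≤ (n + 1) * v₂ - n * v₁ := by
  have h1 : (1 : ℝ) ≤ v₂ := h.one_le_right
  have h2 := (abs_le.1 h.abs_var_sub_le).2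
  have hb : (0 : ℝ) ≤ 5 / b := by positivity
  have h3 : (n : ℝ) * (v₁ - v₂) ≤ n * (5 / b) := by gcongr
  have h4 : 5 * ((n : ℝ) + 1) / b = n * (5 / b) + 5 / b := by ring
  nlinarith

lemma weighted_var_pos (h : GaussianClose b μ₁ μ₂ v₁ v₂) (hn : 5 * ((n : ℝ) + 1) < b) :
    0 < ((n : ℝ) + 1) * v₂ - n * v₁ := by
  have hb : (0 : ℝ) < b := lt_of_le_of_lt (by positivity) hn
  refine lt_of_lt_of_le ?_ h.le_weighted_var
  rw [sub_pos, div_lt_one hb]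
  exact hn

lemma integrable (h : GaussianClose b μ₁ μ₂ v₁ v₂) (hn : 5 * ((n : ℝ) + 1) < b) :
    Integrable fun y => gaussianPDFReal μ₁ v₁ y ^ (n + 1) / gaussianPDFReal μ₂ v₂ y ^ n :=
  integrable_gaussianPDFReal_pow_div_pow _ _ (zero_lt_one.trans_le h.one_le_left)
    (zero_lt_one.trans_le h.one_le_right) n (h.weighted_var_pos hn)

lemma integral_le (h : GaussianClose b μ₁ μ₂ v₁ v₂) (hn : 5 * ((n : ℝ) + 1) < b) (hn0 : 0 < n) :
    ∫ y, gaussianPDFReal μ₁ v₁ y ^ (n + 1) / gaussianPDFReal μ₂ v₂ y ^ n ≤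
      Real.exp (n * batchEps b (n + 1)) := by
  have hb : (0 : ℝ) < b := lt_of_le_of_lt (by positivity) hn
  have hn' : (0 : ℝ) < n := by exact_mod_cast hn0
  have hv₁ : (1 : ℝ) ≤ v₁ := h.one_le_left
  have hv₂ : (1 : ℝ) ≤ v₂ := h.one_le_right
  have hv₂' : (v₂ : ℝ) ≤ 2 := h.right_le_two
  have hw := h.weighted_var_pos hn
  have hd : 0 < (b : ℝ) - 5 * (n + 1) := sub_pos.2 hn
  set w : ℝ := ((n : ℝ) + 1) * v₂ - n * v₁ with hwdef
  have hbw : ((b : ℝ) - 5 * (n + 1)) / b ≤ w := by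
    have := h.le_weighted_var (n := n)
    rwa [sub_div, div_self hb.ne']
  have hwi : w⁻¹ ≤ b / ((b : ℝ) - 5 * (n + 1)) := by
    rw [← inv_div]
    exact inv_anti₀ (by positivity) hbw
  rw [integral_gaussianPDFReal_pow_div_pow _ _ (zero_lt_one.trans_le h.one_le_left)
    (zero_lt_one.trans_le h.one_le_right) n hw rfl]
  have t1 : √(v₂ / v₁ : ℝ) ≤ Real.exp (5 / (2 * b)) := by
    have h1 : (v₂ / v₁ : ℝ) ≤ 1 + 5 / b := by
      rw [div_le_iff₀ (by linarith)]
      have h2 := (abs_le.1 h.abs_var_sub_le).1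
      have h3 : (0 : ℝ) ≤ 5 / b := by positivity
      nlinarith
    have h2 : (v₂ / v₁ : ℝ) ≤ Real.exp (5 / (2 * b)) ^ 2 := by
      rw [← Real.exp_nat_mul]
      refine (h1.trans ?_)
      have h3 : ((2 : ℕ) : ℝ) * (5 / (2 * b)) = 5 / b := by push_cast; field_simp
      rw [h3]
      linarith [Real.add_one_le_exp (5 / b : ℝ)]
    exact Real.sqrt_le_iff.2 ⟨(Real.exp_pos _).le, h2⟩
  have t2 : √(v₂ / w) ≤ Real.exp (1 / 2 * Real.log (2 * b / (b - 5 * (n + 1)))) := by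
    have hpos : (0 : ℝ) < 2 * b / (b - 5 * (n + 1)) := by positivity
    rw [one_div, inv_mul_eq_div, ← Real.log_sqrt hpos.le, Real.exp_log (Real.sqrt_pos.2 hpos)]
    refine Real.sqrt_le_sqrt ?_
    rw [div_eq_mul_inv, mul_div_assoc]
    gcongr
  have t3 : (n : ℝ) * (n + 1) * (μ₁ - μ₂) ^ 2 / (2 * w) ≤
      n * (2 * (n + 1) / (b - 5 * (n + 1))) := by
    have e : (n : ℝ) * (2 * (n + 1) / (b - 5 * (n + 1))) =
        n * (n + 1) * (4 / b) / 2 * (b / (b - 5 * (n + 1))) := by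
      field_simp; ring
    rw [e, mul_comm 2 w, ← div_div, div_right_comm, div_eq_mul_inv _ w]
    gcongr
    exact h.sq_mean_sub_le
  calc √(v₂ / v₁ : ℝ) ^ n * √(v₂ / w) * Real.exp (n * (n + 1) * (μ₁ - μ₂) ^ 2 / (2 * w))
      ≤ Real.exp (5 / (2 * b)) ^ n * Real.exp (1 / 2 * Real.log (2 * b / (b - 5 * (n + 1)))) *
        Real.exp (n * (2 * (n + 1) / (b - 5 * (n + 1)))) := by gcongr
    _ = Real.exp (n * batchEps b (n + 1)) := by
      rw [← Real.exp_nat_mul, ← Real.exp_add, ← Real.exp_add, batchEps]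
      congr 1
      rw [add_sub_cancel_right]
      field_simp

end GaussianClose

lemma batchEps_nonneg {b : ℕ} {a : ℝ} (ha : 1 ≤ a) (hab : 5 * a < b) : 0 ≤ batchEps b a := by
  have hb : (0 : ℝ) < b := by linarith
  have hd : 0 < (b : ℝ) - 5 * a := sub_pos.2 hab
  have hl : 0 ≤ Real.log (2 * b / (b - 5 * a)) :=
    Real.log_nonneg (by rw [le_div_iff₀ hd]; linarith)
  have ha' : 0 ≤ a - 1 := by linarith
  unfold batchEps
  positivity

/-! ### Pointwise inequalities for powers of densities -/

/-- Binomial expansion of `P ^ α` around `Q`, with the terms of order at least two made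
nonnegative. The first-order term integrates to zero when `P` and `Q` are probability densities. -/
lemma pow_div_pow_le_binomial {P Q : ℝ} (hQ : 0 < Q) {α : ℕ} (hα : 2 ≤ α) :
    P ^ α / Q ^ (α - 1) ≤ Q + α * (P - Q) +
      ∑ k ∈ Finset.Icc 2 α, (α.choose k : ℝ) * (|P - Q| ^ k / Q ^ (k - 1)) := by
  have hrange : Finset.range (α + 1) = insert 0 (insert 1 (Finset.Icc 2 α)) := by
    ext k; simp only [Finset.mem_range, Finset.mem_insert, Finset.mem_Icc]; omega
  have hexp := add_pow (P - Q) Q α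
  rw [sub_add_cancel, hrange, Finset.sum_insert (by simp), Finset.sum_insert (by simp)] at hexp
  rw [hexp, add_div, add_div, Finset.sum_div, ← add_assoc]
  have hsplit : Q ^ α = Q ^ (α - 1) * Q := by rw [← pow_succ]; congr 1; omega
  refine add_le_add (add_le_add (le_of_eq ?_) (le_of_eq ?_)) (Finset.sum_le_sum fun k hk => ?_)
  · simp only [pow_zero, Nat.sub_zero, Nat.choose_zero_right, hsplit, Nat.cast_one]
    field_simp
  · simp only [pow_one, Nat.choose_one_right]
    field_simp
  · obtain ⟨hk2, hkα⟩ := Finset.mem_Icc.1 hk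
    have hsplit' : Q ^ (α - 1) = Q ^ (k - 1) * Q ^ (α - k) := by rw [← pow_add]; congr 1; omega
    have hle : (P - Q) ^ k ≤ |P - Q| ^ k := by rw [← abs_pow]; exact le_abs_self _
    calc (P - Q) ^ k * Q ^ (α - k) * (α.choose k : ℝ) / Q ^ (α - 1)
        = (α.choose k : ℝ) * ((P - Q) ^ k / Q ^ (k - 1)) := by rw [hsplit']; field_simp
      _ ≤ _ := by gcongr

/-- Joint convexity of `(u, z) ↦ u ^ (n + 1) / z ^ n`, in homogeneous form. -/
lemma sum_pow_div_sum_pow_le {ι : Type*} (K : Finset ι) {D r : ι → ℝ} (hD : ∀ k ∈ K, 0 ≤ D k)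
    (hr : ∀ k ∈ K, 0 < r k) (n : ℕ) :
    (∑ k ∈ K, D k) ^ (n + 1) / (∑ k ∈ K, r k) ^ n ≤ ∑ k ∈ K, D k ^ (n + 1) / r k ^ n := by
  rcases K.eq_empty_or_nonempty with rfl | hK
  · simp
  have hR : 0 < ∑ k ∈ K, r k := Finset.sum_pos hr hK
  set R := ∑ k ∈ K, r k
  have h := Real.pow_arith_mean_le_arith_mean_pow K (fun k => r k / R) (fun k => D k / r k)
    (fun k hk => (div_pos (hr k hk) hR).le) (by rw [← Finset.sum_div, div_self hR.ne'])
    (fun k hk => div_nonneg (hD k hk) (hr k hk).le) (n + 1)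
  have e1 : ∑ k ∈ K, r k / R * (D k / r k) = (∑ k ∈ K, D k) / R := by
    rw [Finset.sum_div]
    refine Finset.sum_congr rfl fun k hk => ?_
    have := (hr k hk).ne'
    field_simp
  have e2 : ∑ k ∈ K, r k / R * (D k / r k) ^ (n + 1) = (∑ k ∈ K, D k ^ (n + 1) / r k ^ n) / R := by
    rw [Finset.sum_div]
    refine Finset.sum_congr rfl fun k hk => ?_
    have := (hr k hk).ne'
    rw [div_pow, pow_succ (r k)]
    field_simp
  rw [e1, e2, div_pow, le_div_iff₀ hR] at h
  refine le_of_eq_of_le ?_ h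
  rw [pow_succ R]
  field_simp

lemma abs_sub_pow_div_le {p q r : ℝ} (hp : 0 ≤ p) (hq : 0 ≤ q) (hr : 0 < r) (n : ℕ) :
    |p - q| ^ (n + 1) / r ^ n ≤ p ^ (n + 1) / r ^ n + q ^ (n + 1) / r ^ n := by
  rw [← add_div]
  gcongr
  have h1 : |p - q| ≤ max p q :=
    abs_sub_le_iff.2 ⟨by linarith [le_max_left p q], by linarith [le_max_right p q]⟩
  calc |p - q| ^ (n + 1) ≤ max p q ^ (n + 1) := by gcongr
    _ ≤ p ^ (n + 1) + q ^ (n + 1) := by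
      rcases max_cases p q with ⟨h, -⟩ | ⟨h, -⟩ <;> rw [h]
      · linarith [pow_nonneg hq (n + 1)]
      · linarith [pow_nonneg hp (n + 1)]

lemma abs_sub_sq_div_le {p q r : ℝ} (hr : 0 < r) :
    |p - q| ^ 2 / r ≤ 2 * (p ^ 2 / r - 2 * p + r) + 2 * (q ^ 2 / r - 2 * q + r) := by
  have h : 2 * (p ^ 2 / r - 2 * p + r) + 2 * (q ^ 2 / r - 2 * q + r) =
      (2 * (p - r) ^ 2 + 2 * (q - r) ^ 2) / r := by field_simp; ring
  rw [h, sq_abs]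
  gcongr
  nlinarith [sq_nonneg (p + q - 2 * r)]

/-! ### The ternary divergence of close Gaussians -/

/-- The bound on `∫ |p - q| ^ k / r ^ (k - 1)` for three Gaussian densities, where `p` and `q`
are close to `r` in the sense of `GaussianClose`. At order two the first entry of the minimum comes
from `(p - q) ^ 2 ≤ 2 (p - r) ^ 2 + 2 (q - r) ^ 2`, which keeps the cancellation for small `ε`; all
other bounds come from `|p - q| ^ k ≤ p ^ k + q ^ k`. -/
def ternaryBound (ε : ℝ → ℝ) (k : ℕ) : ℝ :=
  if k = 2 then min (4 * (Real.exp (ε 2) - 1)) (2 * Real.exp (ε 2))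
  else 2 * Real.exp (((k : ℝ) - 1) * ε k)

lemma amplifiedEps_eq (ε : ℝ → ℝ) (q : ℝ) {α : ℕ} (hα : 2 ≤ α) :
    amplifiedEps ε q α = 1 / ((α : ℝ) - 1) * Real.log
      (1 + ∑ k ∈ Finset.Icc 2 α, (α.choose k : ℝ) * (q ^ k * ternaryBound ε k)) := by
  have h : Finset.Icc 2 α = insert 2 (Finset.Icc 3 α) := by
    ext k; simp only [Finset.mem_insert, Finset.mem_Icc]; omega
  rw [amplifiedEps, h, Finset.sum_insert (by simp), ← add_assoc, Finset.mul_sum]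
  congr 3
  · simp only [ternaryBound, if_true]; ring
  · refine Finset.sum_congr rfl fun k hk => ?_
    have : k ≠ 2 := by have := (Finset.mem_Icc.1 hk).1; omega
    rw [ternaryBound, if_neg this]
    ring

lemma ternaryBound_nonneg {b k : ℕ} (hk : 2 ≤ k) (hkb : 5 * (k : ℝ) < b) :
    0 ≤ ternaryBound (batchEps b) k := by
  unfold ternaryBound
  split_ifs with h
  · subst h
    have := Real.one_le_exp (batchEps_nonneg (b := b) (a := 2) (by norm_num) (by simpa using hkb))
    exact le_min (by linarith) (by linarith)
  · positivity

section Ternary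

variable {b n : ℕ} {μ₁ μ₂ μ₃ : ℝ} {v₁ v₂ v₃ : ℝ≥0}

lemma integrable_ternary (h₁ : GaussianClose b μ₁ μ₃ v₁ v₃) (h₂ : GaussianClose b μ₂ μ₃ v₂ v₃)
    (hn : 5 * ((n : ℝ) + 1) < b) :
    Integrable fun y => |gaussianPDFReal μ₁ v₁ y - gaussianPDFReal μ₂ v₂ y| ^ (n + 1) /
      gaussianPDFReal μ₃ v₃ y ^ n := by
  refine ((h₁.integrable hn).add (h₂.integrable hn)).mono' ?_ (ae_of_all _ fun y => ?_)
  · have m := fun μ v => measurable_gaussianPDFReal μ v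
    exact (((((m μ₁ v₁).sub (m μ₂ v₂)).abs).pow_const _).div
      ((m μ₃ v₃).pow_const _)).aestronglyMeasurable
  · have hr : 0 < gaussianPDFReal μ₃ v₃ y :=
      gaussianPDFReal_pos _ _ _ (zero_lt_one.trans_le h₁.one_le_right).ne'
    rw [Real.norm_of_nonneg (by positivity)]
    exact abs_sub_pow_div_le (gaussianPDFReal_nonneg _ _ _) (gaussianPDFReal_nonneg _ _ _) hr n

lemma integral_ternary_le (h₁ : GaussianClose b μ₁ μ₃ v₁ v₃) (h₂ : GaussianClose b μ₂ μ₃ v₂ v₃)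
    (hn : 5 * ((n : ℝ) + 1) < b) (hn0 : 0 < n) :
    ∫ y, |gaussianPDFReal μ₁ v₁ y - gaussianPDFReal μ₂ v₂ y| ^ (n + 1) /
      gaussianPDFReal μ₃ v₃ y ^ n ≤ ternaryBound (batchEps b) (n + 1) := by
  have hv₁ : v₁ ≠ 0 := (zero_lt_one.trans_le h₁.one_le_left).ne'
  have hv₂ : v₂ ≠ 0 := (zero_lt_one.trans_le h₂.one_le_left).ne'
  have hv₃ : v₃ ≠ 0 := (zero_lt_one.trans_le h₁.one_le_right).ne'
  have hr : ∀ y, 0 < gaussianPDFReal μ₃ v₃ y := fun y => gaussianPDFReal_pos _ _ _ hv₃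
  have i₁ := h₁.integrable hn
  have i₂ := h₂.integrable hn
  have hgen : ∫ y, |gaussianPDFReal μ₁ v₁ y - gaussianPDFReal μ₂ v₂ y| ^ (n + 1) /
      gaussianPDFReal μ₃ v₃ y ^ n ≤ 2 * Real.exp (n * batchEps b (n + 1)) := by
    refine (integral_mono (integrable_ternary h₁ h₂ hn) (i₁.add i₂) fun y =>
      abs_sub_pow_div_le (gaussianPDFReal_nonneg _ _ _) (gaussianPDFReal_nonneg _ _ _)
        (hr y) n).trans ?_
    rw [integral_add' i₁ i₂]
    linarith [h₁.integral_le hn hn0, h₂.integral_le hn hn0]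
  unfold ternaryBound
  split_ifs with h
  · obtain rfl : n = 1 := by omega
    have e : ((1 : ℕ) : ℝ) * batchEps b ((1 : ℕ) + 1) = batchEps b 2 := by
      norm_num
    rw [e] at hgen
    refine le_min ?_ hgen
    have j : ∀ {μ : ℝ} {v : ℝ≥0}, Integrable (fun y => gaussianPDFReal μ v y) :=
      fun {μ v} => integrable_gaussianPDFReal μ v
    simp only [pow_one, one_add_one_eq_two] at i₁ i₂
    have k₁ : Integrable fun y => gaussianPDFReal μ₁ v₁ y ^ 2 / gaussianPDFReal μ₃ v₃ y -
        2 * gaussianPDFReal μ₁ v₁ y := i₁.sub (j.const_mul 2)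
    have k₂ : Integrable fun y => gaussianPDFReal μ₂ v₂ y ^ 2 / gaussianPDFReal μ₃ v₃ y -
        2 * gaussianPDFReal μ₂ v₂ y := i₂.sub (j.const_mul 2)
    have hi := integrable_ternary h₁ h₂ hn
    simp only [pow_one, one_add_one_eq_two] at hi ⊢
    refine (integral_mono hi (((k₁.add j).const_mul 2).add ((k₂.add j).const_mul 2)) fun y =>
      abs_sub_sq_div_le (hr y)).trans ?_
    have l₁ := h₁.integral_le hn hn0
    have l₂ := h₂.integral_le hn hn0
    rw [e] at l₁ l₂
    simp only [pow_one, one_add_one_eq_two] at l₁ l₂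
    have c₁ : ∫ y, (gaussianPDFReal μ₁ v₁ y ^ 2 / gaussianPDFReal μ₃ v₃ y -
        2 * gaussianPDFReal μ₁ v₁ y) + gaussianPDFReal μ₃ v₃ y =
        (∫ y, gaussianPDFReal μ₁ v₁ y ^ 2 / gaussianPDFReal μ₃ v₃ y) - 1 := by
      rw [integral_add k₁ j, integral_sub i₁ (j.const_mul 2), integral_const_mul,
        integral_gaussianPDFReal_eq_one _ hv₁, integral_gaussianPDFReal_eq_one _ hv₃]
      ring
    have c₂ : ∫ y, (gaussianPDFReal μ₂ v₂ y ^ 2 / gaussianPDFReal μ₃ v₃ y -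
        2 * gaussianPDFReal μ₂ v₂ y) + gaussianPDFReal μ₃ v₃ y =
        (∫ y, gaussianPDFReal μ₂ v₂ y ^ 2 / gaussianPDFReal μ₃ v₃ y) - 1 := by
      rw [integral_add k₂ j, integral_sub i₂ (j.const_mul 2), integral_const_mul,
        integral_gaussianPDFReal_eq_one _ hv₂, integral_gaussianPDFReal_eq_one _ hv₃]
      ring
    rw [integral_add' ((k₁.add j).const_mul 2) ((k₂.add j).const_mul 2), integral_const_mul,
      integral_const_mul]
    simp only [Pi.add_apply]
    rw [c₁, c₂]
    linarith
  · push_cast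
    rwa [add_sub_cancel_right]

end Ternary

/-! ### Privacy amplification by subsampling without replacement -/

/-- The batch obtained from `S ∋ i` by a proposed replacement `j` of `i`: the record `j` takes the
place of `i` unless it is already in `S`, in which case `S` is unchanged. For `S` uniform among
the `b`-element sets that contain `i` and `j` uniform among all indices, the result is uniform among
all `b`-element sets. -/
def replace {ι : Type*} [DecidableEq ι] (i : ι) (S : Finset ι) (j : ι) : Finset ι :=
  insert (if j ∈ S then i else j) (S.erase i)

lemma ite_notMem_erase {ι : Type*} [DecidableEq ι] (i : ι) (S : Finset ι) (j : ι) :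
    (if j ∈ S then i else j) ∉ S.erase i := by
  split_ifs with h <;> simp [h]

lemma card_replace {ι : Type*} [DecidableEq ι] {i : ι} {S : Finset ι} (hi : i ∈ S) (j : ι) :
    (replace i S j).card = S.card := by
  rw [replace, Finset.card_insert_of_notMem (ite_notMem_erase i S j), Finset.card_erase_add_one hi]

lemma sum_sum_replace {ι : Type*} [Fintype ι] [DecidableEq ι] (i : ι) (b : ℕ)
    (F : Finset ι → ℝ) :
    ∑ S ∈ (Finset.univ : Finset ι).powersetCard b with i ∈ S, ∑ j, F (replace i S j) =
      b * ∑ S ∈ (Finset.univ : Finset ι).powersetCard b, F S := by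
  rw [← Finset.sum_filter_add_sum_filter_not (Finset.powersetCard b Finset.univ) (i ∈ ·), mul_add]
  have hsplit : ∀ S ∈ (Finset.univ : Finset ι).powersetCard b |>.filter (i ∈ ·),
      ∑ j, F (replace i S j) = b * F S + ∑ j ∈ Sᶜ, F (insert j (S.erase i)) := by
    intro S hS
    obtain ⟨hS, hi⟩ := Finset.mem_filter.1 hS
    rw [← Finset.sum_add_sum_compl S]
    congr 1
    · rw [Finset.sum_congr rfl (g := fun _ => F S), Finset.sum_const,
        (Finset.mem_powersetCard.1 hS).2, nsmul_eq_mul]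
      intro j hj
      rw [replace, if_pos hj, Finset.insert_erase hi]
    · refine Finset.sum_congr rfl fun j hj => ?_
      rw [replace, if_neg (Finset.mem_compl.1 hj)]
  rw [Finset.sum_congr rfl hsplit, Finset.sum_add_distrib, ← Finset.mul_sum]
  congr 1
  have hcard : ∀ S ∈ (Finset.univ : Finset ι).powersetCard b |>.filter (i ∉ ·),
      (b : ℝ) * F S = ∑ _j ∈ S, F S := by
    intro S hS
    rw [Finset.sum_const, (Finset.mem_powersetCard.1 (Finset.mem_filter.1 hS).1).2, nsmul_eq_mul]
  rw [Finset.mul_sum, Finset.sum_congr rfl hcard, Finset.sum_sigma', Finset.sum_sigma']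
  -- `(S, j) ↦ (R, j)` with `R = S - i + j` is a bijection onto the pairs with `i ∉ R` and `j ∈ R`.
  refine Finset.sum_bij' (fun p _ => ⟨insert p.2 (p.1.erase i), p.2⟩)
    (fun p _ => ⟨insert i (p.1.erase p.2), p.2⟩) ?_ ?_ ?_ ?_ ?_
  · rintro ⟨S, j⟩ h
    simp only [Finset.mem_sigma, Finset.mem_filter, Finset.mem_powersetCard, Finset.subset_univ,
      true_and, Finset.mem_compl, Finset.mem_insert_self, and_true] at h ⊢
    obtain ⟨⟨hc, hi⟩, hj⟩ := h
    have hij : i ≠ j := fun h => hj (h ▸ hi)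
    rw [Finset.card_insert_of_notMem (by simp [hj]), Finset.card_erase_add_one hi]
    exact ⟨hc, by simp [hij]⟩
  · rintro ⟨S, j⟩ h
    simp only [Finset.mem_sigma, Finset.mem_filter, Finset.mem_powersetCard, Finset.subset_univ,
      true_and, Finset.mem_compl] at h ⊢
    obtain ⟨⟨hc, hi⟩, hj⟩ := h
    have hij : j ≠ i := fun h => hi (h ▸ hj)
    rw [Finset.card_insert_of_notMem (by simp [hi]), Finset.card_erase_add_one hj]
    exact ⟨⟨hc, by simp⟩, by simp [hij]⟩
  · rintro ⟨S, j⟩ h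
    simp only [Finset.mem_sigma, Finset.mem_filter, Finset.mem_compl] at h
    obtain ⟨⟨-, hi⟩, hj⟩ := h
    simp only [Sigma.mk.injEq, heq_eq_eq, and_true]
    rw [Finset.erase_insert (by simp [hj]), Finset.insert_erase hi]
  · rintro ⟨S, j⟩ h
    simp only [Finset.mem_sigma, Finset.mem_filter] at h
    obtain ⟨⟨-, hi⟩, hj⟩ := h
    simp only [Sigma.mk.injEq, heq_eq_eq, and_true]
    rw [Finset.erase_insert (by simp [hi]), Finset.insert_erase hj]
  · rintro ⟨S, j⟩ -
    rfl

/-- Amplification by subsampling without replacement. The densities `G S` and `G' S` of the batches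
`S` agree unless `S` contains `i`, and the ternary divergences along the coupling `replace i` are
bounded by `B`. Then the divergence of the two uniform mixtures is bounded, with a factor
`(b / N) ^ k` in the term of order `k`. -/
lemma lintegral_mixture_pow_div_pow_le {N b α : ℕ} (hα : 2 ≤ α) (hb : 0 < b) (hbN : b ≤ N)
    (i : Fin N) {G G' : Finset (Fin N) → ℝ → ℝ}
    (hG'pos : ∀ S ∈ (Finset.univ : Finset (Fin N)).powersetCard b, ∀ y, 0 < G' S y)
    (hGnn : ∀ S y, 0 ≤ G S y)
    (hGint : ∀ S, Integrable (G S)) (hG'int : ∀ S, Integrable (G' S))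
    (hG1 : ∀ S ∈ (Finset.univ : Finset (Fin N)).powersetCard b, ∫ y, G S y = 1)
    (hG'1 : ∀ S ∈ (Finset.univ : Finset (Fin N)).powersetCard b, ∫ y, G' S y = 1)
    (hGG' : ∀ S, i ∉ S → G S = G' S) {B : ℕ → ℝ}
    (hint : ∀ n ∈ Finset.Icc 1 (α - 1), ∀ S ∈ (Finset.univ : Finset (Fin N)).powersetCard b,
      i ∈ S → ∀ j, Integrable fun y =>
        |G S y - G' S y| ^ (n + 1) / G' (replace i S j) y ^ n)
    (hB : ∀ n ∈ Finset.Icc 1 (α - 1), ∀ S ∈ (Finset.univ : Finset (Fin N)).powersetCard b,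
      i ∈ S → ∀ j, ∫ y, |G S y - G' S y| ^ (n + 1) / G' (replace i S j) y ^ n ≤ B (n + 1)) :
    ∫⁻ y, ENNReal.ofReal
      (((N.choose b : ℝ)⁻¹ * ∑ S ∈ (Finset.univ : Finset (Fin N)).powersetCard b, G S y) ^ α /
        ((N.choose b : ℝ)⁻¹ * ∑ S ∈ (Finset.univ : Finset (Fin N)).powersetCard b, G' S y) ^
          (α - 1)) ≤
      ENNReal.ofReal (1 + ∑ k ∈ Finset.Icc 2 α, (α.choose k : ℝ) * (((b : ℝ) / N) ^ k * B k)) := by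
  set U := (Finset.univ : Finset (Fin N)).powersetCard b with hU
  set A := U.filter (i ∈ ·) with hA
  have hC : (0 : ℝ) < N.choose b := by exact_mod_cast Nat.choose_pos hbN
  set C : ℝ := (N.choose b : ℝ) with hCdef
  have hb' : (0 : ℝ) < b := by exact_mod_cast hb
  have hN' : (0 : ℝ) < N := by exact_mod_cast hb.trans_le hbN
  have hUcard : (U.card : ℝ) = C := by simp [hU, hCdef]
  have hUne : U.Nonempty := by
    rw [← Finset.card_pos]; exact_mod_cast hUcard ▸ hC
  have hcount : (∑ _S ∈ A, ∑ _j : Fin N, (1 : ℝ)) = b * C := by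
    rw [sum_sum_replace i b (fun _ => (1 : ℝ)), Finset.sum_const, nsmul_one, ← hU, hUcard]
  set P : ℝ → ℝ := fun y => C⁻¹ * ∑ S ∈ U, G S y with hP
  set Q : ℝ → ℝ := fun y => C⁻¹ * ∑ S ∈ U, G' S y with hQ
  have hQpos : ∀ y, 0 < Q y := fun y =>
    mul_pos (inv_pos.2 hC) (Finset.sum_pos (fun S hS => hG'pos S hS y) hUne)
  have hPnn : ∀ y, 0 ≤ P y := fun y =>
    mul_nonneg (inv_pos.2 hC).le (Finset.sum_nonneg fun S _ => hGnn S y)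
  have hPint : Integrable P := (integrable_finsetSum _ fun S _ => hGint S).const_mul _
  have hQint : Integrable Q := (integrable_finsetSum _ fun S _ => hG'int S).const_mul _
  have hP1 : ∫ y, P y = 1 := by
    simp only [hP]
    rw [integral_const_mul, integral_finsetSum _ fun S _ => hGint S]
    rw [Finset.sum_congr rfl hG1, Finset.sum_const, nsmul_one, hUcard]
    exact inv_mul_cancel₀ hC.ne'
  have hQ1 : ∫ y, Q y = 1 := by
    simp only [hQ]
    rw [integral_const_mul, integral_finsetSum _ fun S _ => hG'int S]
    rw [Finset.sum_congr rfl hG'1, Finset.sum_const, nsmul_one, hUcard]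
    exact inv_mul_cancel₀ hC.ne'
  set H : ℕ → ℝ → ℝ := fun k y => ((b : ℝ) / N) ^ k * ((b * C)⁻¹ *
    ∑ S ∈ A, ∑ j, |G S y - G' S y| ^ k / G' (replace i S j) y ^ (k - 1)) with hH
  have hpoint : ∀ k ∈ Finset.Icc 2 α, ∀ y, |P y - Q y| ^ k / Q y ^ (k - 1) ≤ H k y := by
    intro k hk y
    obtain ⟨n, rfl⟩ : ∃ n, k = n + 1 := ⟨k - 1, by have := (Finset.mem_Icc.1 hk).1; omega⟩
    simp only [hH, add_tsub_cancel_right]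
    -- Both sides are written as sums over the pairs `(S, j)` of the coupling, so that joint convexity
    -- applies; the prefactors leave `(C N) ^ (-(n + 1)) (C b) ^ n = (b / N) ^ (n + 1) / (b C)`.
    have e1 : P y - Q y = (C * N)⁻¹ * ∑ S ∈ A, ∑ _j : Fin N, (G S y - G' S y) := by
      simp only [Finset.sum_const, Finset.card_univ, Fintype.card_fin, nsmul_eq_mul]
      rw [← Finset.mul_sum, hP, hQ, ← mul_sub, ← Finset.sum_sub_distrib,
        ← Finset.sum_filter_add_sum_filter_not U (i ∈ ·)]
      rw [Finset.sum_eq_zero (s := U.filter (i ∉ ·)) fun S hS => by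
        rw [hGG' S (Finset.mem_filter.1 hS).2, sub_self]]
      field_simp
      simp [hA]
    have e2 : Q y = (C * b)⁻¹ * ∑ S ∈ A, ∑ j, G' (replace i S j) y := by
      rw [sum_sum_replace i b (fun S => G' S y)]
      simp only [hQ, hU]
      field_simp
    have e3 : |P y - Q y| ≤ (C * N)⁻¹ * ∑ S ∈ A, ∑ _j : Fin N, |G S y - G' S y| := by
      rw [e1, abs_mul, abs_of_pos (by positivity)]
      gcongr
      refine (Finset.abs_sum_le_sum_abs _ _).trans (Finset.sum_le_sum fun S _ => ?_)
      exact Finset.abs_sum_le_sum_abs _ _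
    have hconv := sum_pow_div_sum_pow_le (A ×ˢ (Finset.univ : Finset (Fin N)))
      (D := fun p => |G p.1 y - G' p.1 y|) (r := fun p => G' (replace i p.1 p.2) y)
      (fun _ _ => abs_nonneg _) (fun p hp => hG'pos _ (by
        obtain ⟨hS, hi⟩ := Finset.mem_filter.1 (Finset.mem_product.1 hp).1
        refine Finset.mem_powersetCard.2 ⟨Finset.subset_univ _, ?_⟩
        rw [card_replace hi]
        exact (Finset.mem_powersetCard.1 hS).2) y) n
    simp only [Finset.sum_product] at hconv
    calc |P y - Q y| ^ (n + 1) / Q y ^ n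
        ≤ ((C * N)⁻¹ * ∑ S ∈ A, ∑ _j : Fin N, |G S y - G' S y|) ^ (n + 1) / Q y ^ n := by
          have := hQpos y
          gcongr
      _ = ((b : ℝ) / N) ^ (n + 1) * ((b * C)⁻¹ *
          ((∑ S ∈ A, ∑ _j : Fin N, |G S y - G' S y|) ^ (n + 1) /
            (∑ S ∈ A, ∑ j, G' (replace i S j) y) ^ n)) := by
          rw [e2]
          generalize ∑ S ∈ A, ∑ _j : Fin N, |G S y - G' S y| = s
          generalize ∑ S ∈ A, ∑ j, G' (replace i S j) y = t
          simp only [mul_pow, div_pow, inv_pow, pow_succ]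
          field_simp
      _ ≤ _ := by gcongr
  have hterm : ∀ k ∈ Finset.Icc 2 α, ∀ S ∈ A, ∀ j, Integrable (fun y =>
      |G S y - G' S y| ^ k / G' (replace i S j) y ^ (k - 1)) ∧
      ∫ y, |G S y - G' S y| ^ k / G' (replace i S j) y ^ (k - 1) ≤ B k := by
    intro k hk S hS j
    obtain ⟨hk1, hk2⟩ := Finset.mem_Icc.1 hk
    obtain ⟨n, rfl⟩ : ∃ n, k = n + 1 := ⟨k - 1, by omega⟩
    have hn : n ∈ Finset.Icc 1 (α - 1) := Finset.mem_Icc.2 ⟨by omega, by omega⟩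
    exact ⟨hint n hn S (Finset.mem_filter.1 hS).1 (Finset.mem_filter.1 hS).2 j,
      hB n hn S (Finset.mem_filter.1 hS).1 (Finset.mem_filter.1 hS).2 j⟩
  have hHint : ∀ k ∈ Finset.Icc 2 α, Integrable (H k) := fun k hk =>
    ((integrable_finsetSum _ fun S hS => integrable_finsetSum _ fun j _ =>
      (hterm k hk S hS j).1).const_mul _).const_mul _
  have hHle : ∀ k ∈ Finset.Icc 2 α, ∫ y, H k y ≤ ((b : ℝ) / N) ^ k * B k := by
    intro k hk
    simp only [hH]
    rw [integral_const_mul, integral_const_mul, integral_finsetSum _ fun S hS =>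
      integrable_finsetSum _ fun j _ => (hterm k hk S hS j).1]
    refine mul_le_mul_of_nonneg_left ?_ (by positivity)
    rw [inv_mul_le_iff₀ (by positivity), ← hcount, Finset.sum_mul]
    refine Finset.sum_le_sum fun S hS => ?_
    rw [integral_finsetSum _ fun j _ => (hterm k hk S hS j).1, Finset.sum_mul]
    refine Finset.sum_le_sum fun j _ => ?_
    rw [one_mul]
    exact (hterm k hk S hS j).2
  have hRint : Integrable fun y => ∑ k ∈ Finset.Icc 2 α, (α.choose k : ℝ) * H k y :=
    integrable_finsetSum _ fun k hk => (hHint k hk).const_mul _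
  have hPQint : Integrable fun y => (α : ℝ) * (P y - Q y) := (hPint.sub hQint).const_mul _
  have hLint : Integrable fun y => Q y + α * (P y - Q y) := hQint.add hPQint
  have hbound : ∀ y, P y ^ α / Q y ^ (α - 1) ≤ (Q y + α * (P y - Q y)) +
      ∑ k ∈ Finset.Icc 2 α, (α.choose k : ℝ) * H k y := fun y =>
    (pow_div_pow_le_binomial (hQpos y) hα).trans (add_le_add_right (Finset.sum_le_sum fun k hk =>
      mul_le_mul_of_nonneg_left (hpoint k hk y) (Nat.cast_nonneg _)) _)
  calc ∫⁻ y, ENNReal.ofReal (P y ^ α / Q y ^ (α - 1))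
      ≤ ∫⁻ y, ENNReal.ofReal ((Q y + α * (P y - Q y)) +
          ∑ k ∈ Finset.Icc 2 α, (α.choose k : ℝ) * H k y) :=
        lintegral_mono fun y => ENNReal.ofReal_le_ofReal (hbound y)
    _ = ENNReal.ofReal (∫ y, (Q y + α * (P y - Q y)) +
          ∑ k ∈ Finset.Icc 2 α, (α.choose k : ℝ) * H k y) := by
        refine (ofReal_integral_eq_lintegral_ofReal (hLint.add hRint)
          (ae_of_all _ fun y => le_trans ?_ (hbound y))).symm
        exact div_nonneg (pow_nonneg (hPnn y) _) (pow_nonneg (hQpos y).le _)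
    _ ≤ _ := by
        refine ENNReal.ofReal_le_ofReal ?_
        rw [integral_add hLint hRint, integral_add hQint hPQint,
          integral_const_mul (α : ℝ), integral_sub hPint hQint, hP1, hQ1, sub_self, mul_zero, add_zero,
          integral_finsetSum _ fun k hk => (hHint k hk).const_mul _]
        refine add_le_add_right (Finset.sum_le_sum fun k hk => ?_) _
        rw [integral_const_mul]
        exact mul_le_mul_of_nonneg_left (hHle k hk) (Nat.cast_nonneg _)

/-! ### One iteration of the subsampled chain -/

lemma HasMoment.of_real_densities {Ω : Type*} [MeasurableSpace Ω] {ρ μ ν : Measure Ω}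
    {g g' : Ω → ℝ} (hg : Measurable g) (hg' : Measurable g') (hg0 : ∀ y, 0 ≤ g y)
    (hg'0 : ∀ y, 0 < g' y) (hμ : μ = ρ.withDensity fun y => ENNReal.ofReal (g y))
    (hν : ν = ρ.withDensity fun y => ENNReal.ofReal (g' y)) {α : ℕ} (hα : 1 ≤ α) {C : ℝ≥0∞}
    (hC : ∫⁻ y, ENNReal.ofReal (g y ^ α / g' y ^ (α - 1)) ∂ρ ≤ C) :
    HasMoment μ ν (fun y => ENNReal.ofReal (g y / g' y)) α C := by
  have hm : Measurable fun y => ENNReal.ofReal (g y / g' y) := (hg.div hg').ennreal_ofReal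
  subst hμ hν
  constructor
  · rw [← withDensity_mul _ hg'.ennreal_ofReal hm]
    congr 1
    ext1 y
    rw [Pi.mul_apply, ← ENNReal.ofReal_mul (hg'0 y).le, mul_div_cancel₀ _ (hg'0 y).ne']
  · rw [lintegral_withDensity_eq_lintegral_mul _ hg'.ennreal_ofReal (hm.pow_const _)]
    refine le_of_eq_of_le (lintegral_congr fun y => ?_) hC
    have h := (hg'0 y).ne'
    have hsplit : g' y ^ α = g' y ^ (α - 1) * g' y := by rw [← pow_succ]; congr 1; omega
    rw [Pi.mul_apply, ENNReal.rpow_natCast, ← ENNReal.ofReal_pow (div_nonneg (hg0 y) (hg'0 y).le),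
      ← ENNReal.ofReal_mul (hg'0 y).le, div_pow, hsplit]
    congr 1
    field_simp

namespace Model

variable {X Θ : Type*} [MeasurableSpace Θ] (M : Model X Θ)

lemma noiseVar_mem_Icc {N b : ℕ} (hb : 0 < b) (hN : 0 < N) {x : Fin N → X}
    {S : Finset (Fin N)} (hS : S.card = b) {θ θ' : Θ}
    (hx : ∀ i, |M.llr (x i) θ θ'| ≤ √(b : ℝ) / N) :
    M.noiseVar b x S θ θ' ∈ Set.Icc (1 : ℝ) 2 := by
  have hb' : (0 : ℝ) < b := by exact_mod_cast hb
  have hN' : (0 : ℝ) < N := by exact_mod_cast hN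
  have hsq : ∀ i, M.llr (x i) θ θ' ^ 2 ≤ b / (N : ℝ) ^ 2 := fun i => by
    have h : (√(b : ℝ) / N) ^ 2 = b / (N : ℝ) ^ 2 := by rw [div_pow, Real.sq_sqrt hb'.le]
    rw [← h, ← sq_abs]
    exact pow_le_pow_left₀ (abs_nonneg _) (hx i) 2
  have h0 : 0 ≤ M.batchVar b x S θ θ' := by
    have h := sq_sum_le_card_mul_sum_sq (s := S) (f := fun i => M.llr (x i) θ θ')
    rw [hS] at h
    rw [batchVar, sub_nonneg, div_pow, div_le_div_iff₀ (by positivity) hb']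
    nlinarith
  have h1 : M.batchVar b x S θ θ' ≤ b / (N : ℝ) ^ 2 := by
    have h : (∑ i ∈ S, M.llr (x i) θ θ' ^ 2) / b ≤ b / (N : ℝ) ^ 2 := by
      rw [div_le_iff₀ hb', mul_comm]
      refine (Finset.sum_le_sum fun i _ => hsq i).trans_eq ?_
      rw [Finset.sum_const, hS, nsmul_eq_mul]
    exact (sub_le_self _ (sq_nonneg _)).trans h
  have h2 : (N : ℝ) ^ 2 / b * M.batchVar b x S θ θ' ≤ 1 := by
    calc (N : ℝ) ^ 2 / b * M.batchVar b x S θ θ' ≤ (N : ℝ) ^ 2 / b * (b / (N : ℝ) ^ 2) := by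
          gcongr
      _ = 1 := by field_simp
  have h3 : 0 ≤ (N : ℝ) ^ 2 / b * M.batchVar b x S θ θ' := by positivity
  exact ⟨by unfold noiseVar; linarith, by unfold noiseVar; linarith⟩

/-- The Gaussians of two batches with all but one record in common. The records outside the common
part `E` are `x l` and `x' l'`. -/
lemma gaussianClose {N b : ℕ} (hN : 0 < N) {x x' : Fin N → X} {θ θ' : Θ}
    (hx : ∀ i, |M.llr (x i) θ θ'| ≤ √(b : ℝ) / N) (hx' : ∀ i, |M.llr (x' i) θ θ'| ≤ √(b : ℝ) / N)
    {E : Finset (Fin N)} {l l' : Fin N} (hl : l ∉ E) (hl' : l' ∉ E) (hE : E.card + 1 = b)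
    (hxx' : ∀ k ∈ E, x k = x' k) :
    GaussianClose b (M.deltaStar b x (insert l E) θ θ') (M.deltaStar b x' (insert l' E) θ θ')
      (M.noiseVar b x (insert l E) θ θ').toNNReal
      (M.noiseVar b x' (insert l' E) θ θ').toNNReal := by
  have hb : 0 < b := by omega
  have hb' : (0 : ℝ) < b := by exact_mod_cast hb
  have hN' : (0 : ℝ) < N := by exact_mod_cast hN
  have hc : (insert l E).card = b := by rw [Finset.card_insert_of_notMem hl, hE]
  have hc' : (insert l' E).card = b := by rw [Finset.card_insert_of_notMem hl', hE]
  have hv := M.noiseVar_mem_Icc hb hN hc hx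
  have hv' := M.noiseVar_mem_Icc hb hN hc' hx'
  set c : ℝ := √(b : ℝ) / N with hcdef
  have hc0 : 0 ≤ c := by positivity
  have hcsq : c ^ 2 = b / (N : ℝ) ^ 2 := by rw [hcdef, div_pow, Real.sq_sqrt hb'.le]
  have hsum : ∀ {z : Fin N → X} {S : Finset (Fin N)}, S.card = b →
      (∀ i, |M.llr (z i) θ θ'| ≤ c) → |∑ i ∈ S, M.llr (z i) θ θ'| ≤ b * c := by
    intro z S hS hz
    refine (Finset.abs_sum_le_sum_abs _ _).trans ((Finset.sum_le_sum fun i _ => hz i).trans_eq ?_)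
    rw [Finset.sum_const, hS, nsmul_eq_mul]
  have hs := hsum hc hx
  have hs' := hsum hc' hx'
  have ht := hx l
  have ht' := hx' l'
  have hd : ∀ F : ℝ → ℝ, ∑ i ∈ insert l E, F (M.llr (x i) θ θ') -
      ∑ i ∈ insert l' E, F (M.llr (x' i) θ θ') =
      F (M.llr (x l) θ θ') - F (M.llr (x' l') θ θ') := by
    intro F
    rw [Finset.sum_insert hl, Finset.sum_insert hl',
      Finset.sum_congr rfl fun k hk => by rw [hxx' k hk]]
    ring
  have hd1 := hd fun r => r
  have hd2 := hd fun r => r ^ 2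
  refine ⟨?_, ?_, ?_, ?_, ?_⟩
  · simpa using Real.toNNReal_le_toNNReal hv.1
  · simpa using Real.toNNReal_le_toNNReal hv'.1
  · exact Real.toNNReal_le_iff_le_coe.2 hv'.2
  · rw [Real.coe_toNNReal _ (by linarith [hv.1]), Real.coe_toNNReal _ (by linarith [hv'.1])]
    unfold noiseVar batchVar
    set s := ∑ i ∈ insert l E, M.llr (x i) θ θ'
    set s' := ∑ i ∈ insert l' E, M.llr (x' i) θ θ'
    set u := ∑ i ∈ insert l E, M.llr (x i) θ θ' ^ 2
    set u' := ∑ i ∈ insert l' E, M.llr (x' i) θ θ' ^ 2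
    set t := M.llr (x l) θ θ'
    set t' := M.llr (x' l') θ θ'
    -- The mean of squares contributes `1 / b`, the square of the mean `4 / b`.
    have b1 : |t ^ 2 - t' ^ 2| ≤ c ^ 2 := by
      have h1 : t ^ 2 ≤ c ^ 2 := by rw [← sq_abs]; exact pow_le_pow_left₀ (abs_nonneg _) ht 2
      have h2 : t' ^ 2 ≤ c ^ 2 := by rw [← sq_abs]; exact pow_le_pow_left₀ (abs_nonneg _) ht' 2
      rw [abs_le]
      constructor <;> nlinarith [sq_nonneg t, sq_nonneg t']
    have b2 : |s ^ 2 - s' ^ 2| ≤ 4 * b * c ^ 2 := by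
      have h1 : |t - t'| ≤ 2 * c := by linarith [abs_sub t t']
      have h2 : |s + s'| ≤ 2 * (b * c) := by linarith [abs_add_le s s']
      rw [show s ^ 2 - s' ^ 2 = (t - t') * (s + s') by rw [← hd1]; ring, abs_mul]
      calc |t - t'| * |s + s'| ≤ 2 * c * (2 * (b * c)) := by gcongr
        _ = 4 * b * c ^ 2 := by ring
    have e : 2 - (N : ℝ) ^ 2 / b * (u / b - (s / b) ^ 2) -
        (2 - (N : ℝ) ^ 2 / b * (u' / b - (s' / b) ^ 2)) =
        (N : ℝ) ^ 2 / b * ((s ^ 2 - s' ^ 2) / b ^ 2 - (t ^ 2 - t' ^ 2) / b) := by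
      rw [← hd2]; ring
    have b3 : |(s ^ 2 - s' ^ 2) / (b : ℝ) ^ 2 - (t ^ 2 - t' ^ 2) / b| ≤
        4 * b * c ^ 2 / (b : ℝ) ^ 2 + c ^ 2 / b := by
      refine (abs_sub _ _).trans ?_
      rw [abs_div, abs_div, abs_of_pos hb', abs_of_pos (by positivity : (0 : ℝ) < (b : ℝ) ^ 2)]
      gcongr
    rw [e, abs_mul, abs_of_pos (by positivity)]
    calc (N : ℝ) ^ 2 / b * |(s ^ 2 - s' ^ 2) / (b : ℝ) ^ 2 - (t ^ 2 - t' ^ 2) / b|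
        ≤ (N : ℝ) ^ 2 / b * (4 * b * c ^ 2 / (b : ℝ) ^ 2 + c ^ 2 / b) := by gcongr
      _ = 5 / (b : ℝ) := by rw [hcsq]; field_simp; norm_num
  · unfold deltaStar
    rw [add_sub_add_right_eq_sub, ← mul_sub, hd1, mul_pow]
    have h1 : |M.llr (x l) θ θ' - M.llr (x' l') θ θ'| ≤ 2 * c := by
      linarith [abs_sub (M.llr (x l) θ θ') (M.llr (x' l') θ θ')]
    calc ((N : ℝ) / b) ^ 2 * (M.llr (x l) θ θ' - M.llr (x' l') θ θ') ^ 2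
        ≤ ((N : ℝ) / b) ^ 2 * (2 * c) ^ 2 := by
          rw [← sq_abs (_ - _)]
          gcongr
      _ = 4 / (b : ℝ) := by rw [mul_pow, hcsq]; field_simp; norm_num

/-- The density of the Gaussian of the batch with index set `S`. -/
def batchDensity {N : ℕ} (b : ℕ) (x : Fin N → X) (p : Θ × Θ) (S : Finset (Fin N)) (y : ℝ) : ℝ :=
  gaussianPDFReal (M.deltaStar b x S p.1 p.2) (M.noiseVar b x S p.1 p.2).toNNReal y

/-- The density of the noisy statistic. It is the Lebesgue density of `M.noisy b x p` only when the
noise variances of all batches are positive. -/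
def noisyDensity {N : ℕ} (b : ℕ) (x : Fin N → X) (p : Θ × Θ) (y : ℝ) : ℝ :=
  (N.choose b : ℝ)⁻¹ *
    ∑ S ∈ (Finset.univ : Finset (Fin N)).powersetCard b, M.batchDensity b x p S y

lemma measurable_noisyDensity {N : ℕ} (b : ℕ) (x : Fin N → X) :
    Measurable fun p : (Θ × Θ) × ℝ => M.noisyDensity b x p.1 p.2 := by
  unfold noisyDensity batchDensity
  refine (Finset.measurable_sum _ fun S _ => ?_).const_mul _
  have h1 : Measurable fun p : (Θ × Θ) × ℝ => M.deltaStar b x S p.1.1 p.1.2 :=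
    (M.measurable_deltaStar b x S).comp measurable_fst
  have h2 : Measurable fun p : (Θ × Θ) × ℝ => ((M.noiseVar b x S p.1.1 p.1.2).toNNReal : ℝ) :=
    ((M.measurable_noiseVar b x S).comp measurable_fst).real_toNNReal.coe_nnreal_real
  unfold gaussianPDFReal
  fun_prop

section Good

variable {N b : ℕ} {x x' : Fin N → X} {p : Θ × Θ}

lemma toNNReal_noiseVar_ne_zero (hb : 0 < b) (hN : 0 < N)
    (hx : ∀ i, |M.llr (x i) p.1 p.2| ≤ √(b : ℝ) / N) {S : Finset (Fin N)}
    (hS : S ∈ (Finset.univ : Finset (Fin N)).powersetCard b) :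
    (M.noiseVar b x S p.1 p.2).toNNReal ≠ 0 := by
  have h := (M.noiseVar_mem_Icc hb hN (Finset.mem_powersetCard.1 hS).2 hx).1
  exact (Real.toNNReal_pos.2 (zero_lt_one.trans_le h)).ne'

lemma batchDensity_nonneg (b : ℕ) (x : Fin N → X) (p : Θ × Θ) (S : Finset (Fin N)) (y : ℝ) :
    0 ≤ M.batchDensity b x p S y :=
  gaussianPDFReal_nonneg _ _ _

lemma noisyDensity_pos (hb : 0 < b) (hbN : b ≤ N)
    (hx : ∀ i, |M.llr (x i) p.1 p.2| ≤ √(b : ℝ) / N) (y : ℝ) : 0 < M.noisyDensity b x p y := by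
  refine mul_pos (inv_pos.2 (by exact_mod_cast Nat.choose_pos hbN)) (Finset.sum_pos
    (fun S hS => gaussianPDFReal_pos _ _ _
      (M.toNNReal_noiseVar_ne_zero hb (hb.trans_le hbN) hx hS)) ?_)
  exact Finset.powersetCard_nonempty.2 (by simpa using hbN)

lemma noisy_eq_withDensity (hb : 0 < b) (hbN : b ≤ N)
    (hx : ∀ i, |M.llr (x i) p.1 p.2| ≤ √(b : ℝ) / N) :
    M.noisy b x p = volume.withDensity fun y => ENNReal.ofReal (M.noisyDensity b x p y) := by
  have hC : (0 : ℝ) < N.choose b := by exact_mod_cast Nat.choose_pos hbN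
  have hdens : (fun y => ENNReal.ofReal (M.noisyDensity b x p y)) = fun y =>
      (N.choose b : ℝ≥0∞)⁻¹ * ∑ S ∈ (Finset.univ : Finset (Fin N)).powersetCard b,
        gaussianPDF (M.deltaStar b x S p.1 p.2) (M.noiseVar b x S p.1 p.2).toNNReal y := by
    ext1 y
    rw [noisyDensity, ENNReal.ofReal_mul (inv_pos.2 hC).le, ENNReal.ofReal_inv_of_pos hC,
      ENNReal.ofReal_natCast,
      ENNReal.ofReal_sum_of_nonneg fun S _ => M.batchDensity_nonneg b x p S y]
    rfl
  rw [hdens]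
  refine Measure.ext fun s hs => ?_
  change ((N.choose b : ℝ≥0∞)⁻¹ • ∑ S ∈ (Finset.univ : Finset (Fin N)).powersetCard b,
    M.batchGaussian b x S p.1 p.2) s = _
  rw [withDensity_apply _ hs, lintegral_const_mul _ (Finset.measurable_sum _ fun S _ =>
    measurable_gaussianPDF _ _), lintegral_finsetSum _ fun S _ => measurable_gaussianPDF _ _]
  simp only [Measure.smul_apply, Measure.coe_finsetSum, Finset.sum_apply, smul_eq_mul]
  congr 1
  refine Finset.sum_congr rfl fun S hS => ?_
  rw [batchGaussian, gaussianReal_of_var_ne_zero _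
    (M.toNNReal_noiseVar_ne_zero hb (hb.trans_le hbN) hx hS), withDensity_apply _ hs]

/-- The noisy statistics of adjacent datasets, for a proposal at which the log-likelihood ratios
are bounded. -/
lemma hasMoment_noisy (hbN : b ≤ N) {α : ℕ} (hα : 2 ≤ α) (hαb : 5 * (α : ℝ) < b) {i : Fin N}
    (hadj : ∀ j, j ≠ i → x j = x' j)
    (hx : ∀ i, |M.llr (x i) p.1 p.2| ≤ √(b : ℝ) / N)
    (hx' : ∀ i, |M.llr (x' i) p.1 p.2| ≤ √(b : ℝ) / N) :
    HasMoment (M.noisy b x p) (M.noisy b x' p)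
      (fun y => ENNReal.ofReal (M.noisyDensity b x p y / M.noisyDensity b x' p y)) α
      (ENNReal.ofReal (1 + ∑ k ∈ Finset.Icc 2 α,
        (α.choose k : ℝ) * (((b : ℝ) / N) ^ k * ternaryBound (batchEps b) k))) := by
  have hb : 0 < b := by
    have : (0 : ℝ) < b := lt_of_le_of_lt (by positivity) hαb
    exact_mod_cast this
  have hN : 0 < N := hb.trans_le hbN
  have hm : ∀ z : Fin N → X, Measurable fun y => M.noisyDensity b z p y := fun z => by
    have h := (M.measurable_noisyDensity b z).comp (measurable_prodMk_left (x := p))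
    exact h
  refine HasMoment.of_real_densities (hm x) (hm x')
    (fun y => (M.noisyDensity_pos hb hbN hx y).le) (M.noisyDensity_pos hb hbN hx')
    (M.noisy_eq_withDensity hb hbN hx) (M.noisy_eq_withDensity hb hbN hx') (by omega) ?_
  have hclose : ∀ S ∈ (Finset.univ : Finset (Fin N)).powersetCard b, i ∈ S → ∀ j,
      ∀ z : Fin N → X, (∀ k, k ≠ i → z k = x' k) → (∀ k, |M.llr (z k) p.1 p.2| ≤ √(b : ℝ) / N) →
      GaussianClose b (M.deltaStar b z S p.1 p.2)
        (M.deltaStar b x' (replace i S j) p.1 p.2) (M.noiseVar b z S p.1 p.2).toNNReal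
        (M.noiseVar b x' (replace i S j) p.1 p.2).toNNReal := by
    intro S hS hi j z hz hzb
    have h := M.gaussianClose hN hzb hx' (Finset.notMem_erase i S) (ite_notMem_erase i S j)
      (by rw [Finset.card_erase_add_one hi, (Finset.mem_powersetCard.1 hS).2])
      (fun k hk => hz k (Finset.ne_of_mem_erase hk))
    rwa [Finset.insert_erase hi] at h
  have hord : ∀ n ∈ Finset.Icc 1 (α - 1), 5 * ((n : ℝ) + 1) < b := by
    intro n hn
    have h : n + 1 ≤ α := by have := (Finset.mem_Icc.1 hn).2; omega
    have h' : (n : ℝ) + 1 ≤ α := by exact_mod_cast h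
    linarith
  have hpos : ∀ S ∈ (Finset.univ : Finset (Fin N)).powersetCard b, ∀ y,
      0 < M.batchDensity b x' p S y := fun S hS y =>
    gaussianPDFReal_pos _ _ _ (M.toNNReal_noiseVar_ne_zero hb hN hx' hS)
  have hint : ∀ (z : Fin N → X) (S : Finset (Fin N)), Integrable (M.batchDensity b z p S) :=
    fun z S => integrable_gaussianPDFReal _ _
  have hone : ∀ z : Fin N → X, (∀ k, |M.llr (z k) p.1 p.2| ≤ √(b : ℝ) / N) →
      ∀ S ∈ (Finset.univ : Finset (Fin N)).powersetCard b, ∫ y, M.batchDensity b z p S y = 1 :=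
    fun z hz S hS => integral_gaussianPDFReal_eq_one _ (M.toNNReal_noiseVar_ne_zero hb hN hz hS)
  have hter : ∀ n ∈ Finset.Icc 1 (α - 1), ∀ S ∈ (Finset.univ : Finset (Fin N)).powersetCard b,
      i ∈ S → ∀ j, (Integrable fun y => |M.batchDensity b x p S y - M.batchDensity b x' p S y| ^
        (n + 1) / M.batchDensity b x' p (replace i S j) y ^ n) ∧
      ∫ y, |M.batchDensity b x p S y - M.batchDensity b x' p S y| ^ (n + 1) /
        M.batchDensity b x' p (replace i S j) y ^ n ≤ ternaryBound (batchEps b) (n + 1) := by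
    intro n hn S hS hi j
    have h1 := hclose S hS hi j x hadj hx
    have h2 := hclose S hS hi j x' (fun _ _ => rfl) hx'
    simp only [batchDensity]
    exact ⟨integrable_ternary h1 h2 (hord n hn),
      integral_ternary_le h1 h2 (hord n hn) (Finset.mem_Icc.1 hn).1⟩
  unfold noisyDensity
  refine lintegral_mixture_pow_div_pow_le hα hb hbN i hpos (M.batchDensity_nonneg b x p) (hint x)
    (hint x') (hone x hx) (hone x' hx') (fun S hS => ?_)
    (fun n hn S hS hi j => (hter n hn S hS hi j).1) (fun n hn S hS hi j => (hter n hn S hS hi j).2)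
  have hllr : ∀ k ∈ S, x k = x' k := fun k hk => hadj k fun h => hS (h ▸ hk)
  have h1 : M.deltaStar b x S p.1 p.2 = M.deltaStar b x' S p.1 p.2 := by
    unfold deltaStar
    rw [Finset.sum_congr rfl fun k hk => by rw [hllr k hk]]
  have h2 : M.noiseVar b x S p.1 p.2 = M.noiseVar b x' S p.1 p.2 := by
    unfold noiseVar batchVar
    rw [Finset.sum_congr rfl fun k hk => by rw [hllr k hk],
      Finset.sum_congr (f := fun k => M.llr (x k) p.1 p.2) rfl fun k hk => by rw [hllr k hk]]
  ext1 y
  rw [batchDensity, batchDensity, h1, h2]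

end Good

/-- The density ratio of an iteration is that of its noisy statistic. -/
lemma hasMoment_iteration {N b : ℕ} (hbN : b ≤ N) {x x' : Fin N → X} {α : ℝ} (hα : 0 ≤ α)
    {f : (Θ × Θ) × ℝ → ℝ≥0∞} (hf : Measurable f) {C : ℝ≥0∞} {θ : Θ}
    (h : ∀ᵐ θ' ∂M.proposal θ, HasMoment (M.noisy b x (θ, θ')) (M.noisy b x' (θ, θ'))
      (fun y => f ((θ, θ'), y)) α C) :
    HasMoment (M.iteration b x θ) (M.iteration b x' θ) (fun r => f ((θ, r.1.1.1), r.1.1.2)) α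
      C := by
  have := M.isMarkovKernel_noisy hbN x
  have := M.isMarkovKernel_noisy hbN x'
  have hprod : ∀ z : Fin N → X, IsMarkovKernel (M.noisy b z) →
      (M.proposal ⊗ₖ M.noisy b z) ×ₖ Kernel.const Θ M.cor =
        (M.proposal ⊗ₖ M.noisy b z) ⊗ₖ Kernel.const (Θ × (Θ × ℝ)) M.cor := by
    intro z hz
    refine Kernel.ext fun a => Measure.ext_of_lintegral _ fun g hg => ?_
    rw [Kernel.lintegral_prod _ _ _ hg, Kernel.lintegral_compProd _ _ _ hg]
    simp
  -- The proposal, the correction noise and the update have the same law for both datasets.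
  have h1 := HasMoment.compProd (κ₁ := M.proposal) (η₁ := M.proposal) (f₁ := fun _ => 1)
    measurable_const hf hα (HasMoment.refl _ α) h
  have h2 := HasMoment.compProd (κ₂ := Kernel.const (Θ × (Θ × ℝ)) M.cor)
    (η₂ := Kernel.const (Θ × (Θ × ℝ)) M.cor)
    (f₁ := fun p : Θ × (Θ × ℝ) => 1 * f ((p.1, p.2.1), p.2.2)) (f₂ := fun _ => 1)
    ((hf.comp (by fun_prop)).const_mul 1) measurable_const hα h1
    (ae_of_all _ fun _ => HasMoment.refl _ α)
  have h3 := HasMoment.compProd (κ₂ := Kernel.deterministic M.next M.measurable_next)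
    (η₂ := Kernel.deterministic M.next M.measurable_next)
    (f₁ := fun p : Θ × ((Θ × ℝ) × ℝ) => 1 * f ((p.1, p.2.1.1), p.2.1.2) * 1)
    (f₂ := fun _ => 1)
    (((hf.comp (by fun_prop)).const_mul 1).mul_const 1) measurable_const hα h2
    (ae_of_all _ fun _ => HasMoment.refl _ α)
  unfold iteration
  rw [hprod x ‹_›, hprod x' ‹_›]
  simpa using h3

/-! ### Composition of the iterations -/

lemma exists_hasMoment_run {N b : ℕ} (hbN : b ≤ N) {x x' : Fin N → X} {α : ℝ} (hα : 0 ≤ α)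
    {f : Θ × Record Θ → ℝ≥0∞} (hf : Measurable f) {C : ℝ≥0∞}
    (h : ∀ θ, HasMoment (M.iteration b x θ) (M.iteration b x' θ) (fun r => f (θ, r)) α C) (T : ℕ) :
    ∃ F : Θ × (Fin T → Record Θ) → ℝ≥0∞, Measurable F ∧
      ∀ θ, HasMoment (M.run b x T θ) (M.run b x' T θ) (fun ω => F (θ, ω)) α (C ^ T) := by
  induction T with
  | zero =>
    refine ⟨fun _ => 1, measurable_const, fun θ => ?_⟩
    have := M.isMarkovKernel_run hbN x 0
    rw [pow_zero]
    exact HasMoment.refl (M.run b x 0 θ) α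
  | succ T ih =>
    obtain ⟨F, hF, hFT⟩ := ih
    have := M.isMarkovKernel_iteration hbN x
    have := M.isMarkovKernel_iteration hbN x'
    have := M.isMarkovKernel_run hbN x T
    have := M.isMarkovKernel_run hbN x' T
    have hg : Measurable fun r : Fin (T + 1) → Record Θ => (r 0, Fin.tail r) := by
      unfold Fin.tail
      fun_prop
    have hnext : Measurable fun p : Θ × Record Θ => p.2.2 := measurable_snd.comp measurable_snd
    refine ⟨fun p => f (p.1, p.2 0) * F ((p.2 0).2, Fin.tail p.2), ?_, fun θ => ?_⟩
    · refine (hf.comp (by fun_prop)).mul (hF.comp ?_)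
      unfold Fin.tail
      fun_prop
    · have h1 := HasMoment.compProd (κ₂ := (M.run b x T).comap _ hnext)
        (η₂ := (M.run b x' T).comap _ hnext)
        (f₂ := fun p : (Θ × Record Θ) × (Fin T → Record Θ) => F (p.1.2.2, p.2))
        hf (hF.comp (by fun_prop)) hα (h θ) (ae_of_all _ fun r => hFT r.2)
      have h2 := h1.map_of_leftInverse (m := fun p : Record Θ × (Fin T → Record Θ) =>
          (Fin.cons p.1 p.2 : Fin (T + 1) → Record Θ))
        ((hf.comp (by fun_prop)).mul (hF.comp (by fun_prop))) (measurable_cons T) hg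
        (fun p => by simp)
      simp only [run]
      rw [Kernel.map_apply _ (measurable_cons T), Kernel.map_apply _ (measurable_cons T), pow_succ']
      exact h2

lemma exists_hasMoment_transcript {N b : ℕ} (hbN : b ≤ N) {x x' : Fin N → X} {α : ℝ} (hα : 0 ≤ α)
    {f : Θ × Record Θ → ℝ≥0∞} (hf : Measurable f) {C : ℝ≥0∞}
    (h : ∀ θ, HasMoment (M.iteration b x θ) (M.iteration b x' θ) (fun r => f (θ, r)) α C) (T : ℕ) :
    ∃ F : Θ × (Fin T → Record Θ) → ℝ≥0∞, Measurable F ∧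
      HasMoment (M.transcript b T x) (M.transcript b T x') F α (C ^ T) := by
  obtain ⟨F, hF, hFT⟩ := M.exists_hasMoment_run hbN hα hf h T
  have := M.isMarkovKernel_run hbN x T
  have := M.isMarkovKernel_run hbN x' T
  refine ⟨F, hF, ?_⟩
  have h1 := HasMoment.compProd (a := ()) (κ₁ := Kernel.const Unit M.init)
    (η₁ := Kernel.const Unit M.init) (κ₂ := Kernel.prodMkLeft Unit (M.run b x T))
    (η₂ := Kernel.prodMkLeft Unit (M.run b x' T)) (f₁ := fun _ => 1)
    (f₂ := fun p => F (p.1.2, p.2)) measurable_const (hF.comp (by fun_prop)) hα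
    (HasMoment.refl _ α) (ae_of_all _ fun θ => hFT θ)
  simpa [transcript, Measure.compProd] using h1

end Model

end DPMCMC

end

theorem corollary2 {X Θ : Type*} [MeasurableSpace Θ] (M : DPMCMC.Model X Θ)
    (N b T α : ℕ) (q : ℝ)
    (hbN : b ≤ N)
    (hq : q = (b : ℝ) / N)
    (hα : 2 ≤ α)
    (hαb : (α : ℝ) < (b : ℝ) / 5)
    (hlik : ∀ (x : X) (θ : Θ), ∀ᵐ θ' ∂(M.proposal θ),
      |Real.log (M.lik x θ') - Real.log (M.lik x θ)| ≤ √(b : ℝ) / N) :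
    DPMCMC.IsRDP (fun x : Fin N → X => M.chain b T x) α
        (T * DPMCMC.amplifiedEps (DPMCMC.batchEps b) q α) ∧
      DPMCMC.IsRDP (fun x : Fin N → X => M.transcript b T x) α
        (T * DPMCMC.amplifiedEps (DPMCMC.batchEps b) q α) := by
  have hα1 : (1 : ℝ) < α := by exact_mod_cast hα
  have hα0 : (0 : ℝ) < (α : ℝ) - 1 := sub_pos.2 hα1
  have hαb' : 5 * (α : ℝ) < b := by linarith
  set B : ℝ := 1 + ∑ k ∈ Finset.Icc 2 α,
    (α.choose k : ℝ) * (q ^ k * DPMCMC.ternaryBound (DPMCMC.batchEps b) k) with hB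
  have hBpos : 0 < B := by
    have hq0 : 0 ≤ q := by rw [hq]; positivity
    refine add_pos_of_pos_of_nonneg one_pos (Finset.sum_nonneg fun k hk => ?_)
    obtain ⟨hk2, hkα⟩ := Finset.mem_Icc.1 hk
    have hkα' : (k : ℝ) ≤ α := by exact_mod_cast hkα
    have := DPMCMC.ternaryBound_nonneg (b := b) hk2 (by linarith)
    positivity
  have hpow : ENNReal.ofReal B ^ T = ENNReal.ofReal
      (Real.exp (((α : ℝ) - 1) * (T * DPMCMC.amplifiedEps (DPMCMC.batchEps b) q α))) := by
    rw [DPMCMC.amplifiedEps_eq _ _ hα, ← hB, ← ENNReal.ofReal_pow hBpos.le]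
    congr 1
    rw [show ((α : ℝ) - 1) * (T * (1 / ((α : ℝ) - 1) * Real.log B)) = T * Real.log B by
      field_simp, Real.exp_nat_mul, Real.exp_log hBpos]
  have hllr : ∀ (x : Fin N → X) (θ : Θ), ∀ᵐ θ' ∂(M.proposal θ),
      ∀ i, |M.llr (x i) θ θ'| ≤ √(b : ℝ) / N := by
    intro x θ
    refine ae_all_iff.2 fun i => ?_
    filter_upwards [hlik (x i) θ] with θ' h
    rwa [DPMCMC.Model.llr, Real.log_div (M.lik_pos _ _).ne' (M.lik_pos _ _).ne']
  have key : ∀ x x' : Fin N → X, DPMCMC.Adjacent x x' → ∃ F, Measurable F ∧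
      DPMCMC.HasMoment (M.transcript b T x) (M.transcript b T x') F α (ENNReal.ofReal
        (Real.exp (((α : ℝ) - 1) * (T * DPMCMC.amplifiedEps (DPMCMC.batchEps b) q α)))) := by
    rintro x x' ⟨i, hadj⟩
    have hm : Measurable fun p : (Θ × Θ) × ℝ =>
        ENNReal.ofReal (M.noisyDensity b x p.1 p.2 / M.noisyDensity b x' p.1 p.2) :=
      ((M.measurable_noisyDensity b x).div (M.measurable_noisyDensity b x')).ennreal_ofReal
    rw [← hpow]
    refine M.exists_hasMoment_transcript hbN (by linarith)
      (f := fun p => ENNReal.ofReal (M.noisyDensity b x (p.1, p.2.1.1.1) p.2.1.1.2 /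
        M.noisyDensity b x' (p.1, p.2.1.1.1) p.2.1.1.2))
      (hm.comp (g := _) (f := fun p : Θ × DPMCMC.Record Θ => ((p.1, p.2.1.1.1), p.2.1.1.2))
        (by fun_prop)) (fun θ => ?_) T
    refine M.hasMoment_iteration hbN (by linarith) hm ?_
    filter_upwards [hllr x θ, hllr x' θ] with θ' h h'
    rw [hB, hq]
    exact M.hasMoment_noisy hbN hα hαb' hadj h h'
  constructor
  · intro x x' hxx'
    obtain ⟨F, hF, h⟩ := key x x' hxx'
    have := M.isProbabilityMeasure_transcript hbN x T
    have := M.isProbabilityMeasure_transcript hbN x' T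
    have := M.isProbabilityMeasure_chain hbN x' T
    exact DPMCMC.HasMoment.renyiDiv_le (Measure.measurable_rnDeriv _ _) hα1
      (h.map hF hα1 DPMCMC.Model.measurable_states)
  · intro x x' hxx'
    obtain ⟨F, hF, h⟩ := key x x' hxx'
    have := M.isProbabilityMeasure_transcript hbN x' T
    exact h.renyiDiv_le hF hα1
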